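/- Let $\Lambda$ be the ring of symmetric functions over $\mathbb Z$ (bounded-degree symmetric formal power series in countably many variables), with complete homogeneous symmetric functions $h_1,h_2,\dots$ and Schur functions $s_\lambda=\sum_T x^T$, where $T$ runs over the semistandard Young tableaux of shape $\lambda$. Let $\mathbb F_q$ be the finite field with $q$ elements. For $b\in\mathbb F_q$ let $P(s_\lambda\mapsto b)$ be the probability that $\varphi(s_\lambda)=b$, where $\varphi:\Lambda\to\mathbb F_q$ is a uniformly random ring homomorphism, that is, the values $\varphi(h_1),\varphi(h_2),\dots$ are independent and uniformly distributed in $\mathbb F_q$. Let $(a^n)$ denote the rectangular partition with $n$ parts equal to $a$. Let $b\in\mathbb F_q$ be nonzero, let $\operatorname{ord}(b)$ be its order in the group $\mathbb F_q^\times$, and let $a\ge n\ge 1$ be integers. For a positive integer $d$ put $$g_b(d)=\begin{cases} d & \text{if } d\mid \frac{q-1}{\operatorname{ord}(b)},\\ 0 & \text{otherwise,}\end{cases}\qquad f_b(d)=\sum_{e\mid d}\mu(e)\,g_b(d/e),$$ where $\mu$ is the Möbius function. Then: 1. $$P(s_{(a^n)}\mapsto b)=\sum_{d\mid\gcd(q-1,n)}\frac{f_b(d)}{q^{\,n(d-1)/d+1}}.$$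 2. $$P(s_{(a^n)}\mapsto b)=\sum_{k\ge1}\ \sum_{(c_1,\dots,c_k)}\frac{(q-1)^{k-1}}{q^n}\,g_b\bigl(\gcd(c_1,\dots,c_k,q-1)\bigr),$$ where the inner sum is over the compositions (ordered partitions) of $n$ into $k$ positive parts. 3. If $\operatorname{ord}(b)=q-1$, then $$P(s_{(a^n)}\mapsto b)=\sum_{d\mid\gcd(q-1,n)}\frac{\mu(d)}{q^{\,n(d-1)/d+1}}.$$ 4. $$P(s_{(a^n)}\mapsto 1)=\sum_{d\mid\gcd(q-1,n)}\frac{\phi(d)}{q^{\,n(d-1)/d+1}},$$ where $\phi$ is Euler's totient function. -/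

import Mathlib

noncomputable section

namespace SchurProb

/-- The ring `Λ` of symmetric functions over `ℤ` in the variables `x_0, x_1, x_2, …`: the formal
power series with integer coefficients that have bounded degree and are invariant under every
permutation of the variables. (A monomial involves only finitely many variables, so invariance
under all permutations of `ℕ` is the same as invariance under the finitary ones.) -/
def SymmetricFunctions : Subring (MvPowerSeries ℕ ℤ) where
  carrier := {f | (∃ N : ℕ, ∀ d : ℕ →₀ ℕ, N < d.degree → MvPowerSeries.coeff d f = 0) ∧
    ∀ σ : Equiv.Perm ℕ, MvPowerSeries.rename σ f = f}
  mul_mem' := by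
    rintro f g ⟨⟨N, hN⟩, hf⟩ ⟨⟨M, hM⟩, hg⟩
    refine ⟨⟨N + M, fun d hd => ?_⟩, fun σ => by rw [map_mul, hf, hg]⟩
    classical
    rw [MvPowerSeries.coeff_mul]
    refine Finset.sum_eq_zero fun p hp => ?_
    have hpd : p.1.degree + p.2.degree = d.degree := by
      rw [← map_add, Finset.HasAntidiagonal.mem_antidiagonal.mp hp]
    by_cases h : N < p.1.degree
    · rw [hN _ h, zero_mul]
    · rw [hM _ (by omega), mul_zero]
  one_mem' := by
    refine ⟨⟨0, fun d hd => ?_⟩, fun σ => map_one _⟩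
    classical
    rw [MvPowerSeries.coeff_one, if_neg]
    rintro rfl
    simp at hd
  add_mem' := by
    rintro f g ⟨⟨N, hN⟩, hf⟩ ⟨⟨M, hM⟩, hg⟩
    refine ⟨⟨N + M, fun d hd => ?_⟩, fun σ => by rw [map_add, hf, hg]⟩
    rw [map_add, hN _ (by omega), hM _ (by omega), add_zero]
  zero_mem' := ⟨⟨0, fun d _ => by simp⟩, fun σ => map_zero _⟩
  neg_mem' := by
    rintro f ⟨⟨N, hN⟩, hf⟩
    refine ⟨⟨N, fun d hd => ?_⟩, fun σ => by rw [map_neg, hf]⟩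
    rw [map_neg, hN _ hd, neg_zero]

/-- The complete homogeneous symmetric function `h_k`: the sum of all monomials of degree `k`. -/
def h (k : ℕ) : SymmetricFunctions :=
  ⟨fun d => if d.degree = k then 1 else 0, by
    have hc : ∀ d : ℕ →₀ ℕ, MvPowerSeries.coeff d
        (fun d : ℕ →₀ ℕ => if d.degree = k then (1 : ℤ) else 0) =
        if d.degree = k then 1 else 0 := fun _ => rfl
    refine ⟨⟨k, fun d hd => ?_⟩, fun σ => ?_⟩
    · rw [hc, if_neg (by omega)]
    · ext d
      obtain ⟨e, rfl⟩ : ∃ e : ℕ →₀ ℕ, e.embDomain σ.toEmbedding = d :=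
        ⟨d.embDomain σ.symm.toEmbedding, by
          simp only [Finsupp.embDomain_eq_mapDomain, ← Finsupp.mapDomain_comp]
          simp⟩
      have := MvPowerSeries.coeff_embDomain_rename σ.toEmbedding
        (fun d : ℕ →₀ ℕ => if d.degree = k then (1 : ℤ) else 0) e
      refine this.trans ?_
      rw [hc, hc]
      have hdeg : (e.embDomain σ.toEmbedding).degree = e.degree := by
        rw [Finsupp.degree_apply, Finsupp.degree_apply, Finsupp.support_embDomain,
          Finset.sum_map]
        exact Finset.sum_congr rfl fun x _ => Finsupp.embDomain_apply_self _ _ _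
      rw [hdeg]⟩

/-- The exponent vector of the monomial `x^T` attached to a semistandard tableau `T`: its value
at `i` is the number of cells of `T` with entry `i`. -/
def content {lam : YoungDiagram} (T : SemistandardYoungTableau lam) : ℕ →₀ ℕ :=
  ∑ c ∈ lam.cells, Finsupp.single (T c.1 c.2) 1

/-- The Schur function `s_λ = ∑_T x^T`, the sum over all semistandard Young tableaux of shape
`λ`, as a formal power series: the coefficient of a monomial is the (finite) number of tableaux
with that content. -/
def schur (lam : YoungDiagram) : MvPowerSeries ℕ ℤ :=
  fun d => (Nat.card {T : SemistandardYoungTableau lam // content T = d} : ℤ)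

/-- The rectangle `(a^n)`: `n` rows of length `a`. -/
def rectangle (n a : ℕ) : YoungDiagram :=
  YoungDiagram.ofRowLens (List.replicate n a) (List.pairwise_replicate_of_refl).sortedGE

/-- The law of a sequence of independent, uniformly distributed elements of the finite
field `F`. -/
def uniformSequence (F : Type*) [Field F] [Fintype F] :
    @MeasureTheory.Measure (ℕ → F) (@MeasurableSpace.pi ℕ (fun _ => F) fun _ => ⊤) :=
  letI : MeasurableSpace F := ⊤
  MeasureTheory.Measure.infinitePi fun _ : ℕ => (PMF.uniformOfFintype F).toMeasure

/-- `P(s_λ ↦ b)`: the probability that a uniformly random ring homomorphism `φ : Λ → F` sends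
`s_λ` to `b`. A random homomorphism is given by choosing the images `φ(h_1), φ(h_2), …`
independently and uniformly in `F`; the image of `h_{k+1}` is `c k`. -/
def P {F : Type*} [Field F] [Fintype F] (lam : YoungDiagram) (b : F) : ℝ :=
  (uniformSequence F).real {c : ℕ → F | ∃ φ : SymmetricFunctions →+* F,
    (∀ k, φ (h (k + 1)) = c k) ∧
    ∃ s : SymmetricFunctions, (s : MvPowerSeries ℕ ℤ) = schur lam ∧ φ s = b}

/-- `g_b(d) = d` if `d` divides `(q - 1) / ord(b)`, and `g_b(d) = 0` otherwise. For `b ≠ 0`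
the order of `b` in the multiplicative monoid of `F` is its order in `Fˣ`. -/
def g {F : Type*} [Field F] [Fintype F] (b : F) (d : ℕ) : ℕ :=
  if d ∣ (Fintype.card F - 1) / orderOf b then d else 0

/-- The Möbius inverse of `g_b`: `f_b(d) = ∑_{e ∣ d} μ(e) g_b(d / e)`. -/
def f {F : Type*} [Field F] [Fintype F] (b : F) (d : ℕ) : ℤ :=
  ∑ e ∈ d.divisors, ArithmeticFunction.moebius e * (g b (d / e) : ℤ)

/-- The greatest common divisor `gcd(c_1, …, c_k, m)` of the parts of a composition and `m`. -/
def partsGcd {n : ℕ} (c : Composition n) (m : ℕ) : ℕ :=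
  c.blocks.foldr Nat.gcd m

end SchurProb

end

/-!
A random homomorphism sends the Schur function of a rectangle to the determinant of a random
Toeplitz matrix, so the probability is a proportion of Toeplitz matrices over a finite field.

*Reduction to Toeplitz matrices.* By the Jacobi–Trudi identity (`schur_rectangle_eq_det`), the
Schur function of `(a^n)` is `det (h_{a - i + j})`, and for `n ≤ a` all the indices are positive.
The identity is proved in finitely many variables (`schurSum_eq_jacobiTrudi`): removing the largest
entry of a tableau removes a horizontal strip from its shape, and the determinant satisfies the same
recursion, since subtracting from each row a multiple of the next one leaves in row `i` a sum over
the possible lengths of the new row, and the determinant is multilinear. The values of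
`h_1, h_2, …` can be prescribed arbitrarily (`exists_ringHom_apply_h`): in `N` variables the
fundamental theorem on symmetric polynomials gives a homomorphism with the prescribed values on
`h_1, …, h_N`, and since the field is finite, these homomorphisms have a limit along an ultrafilter.
The entries of the matrix are thus `2n - 1` independent uniform elements
(`P_rectangle_eq_toeplitzCount`).

*Counting.* Suppose that the sequence of diagonals starts with `c - 1` zeros followed by `u ≠ 0`. It
is the coefficient sequence of `X ^ (c - 1) * A` for an invertible power series `A`, and the
Toeplitz matrix is a block of the triangular matrix of multiplication by `A`. Jacobi's identity for
complementary minors expresses its determinant by a Toeplitz determinant of size `n - c` formed from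
the coefficients of the inverse of `A` (`exists_sign_det_minor_eq`). As inversion permutes the
coefficient sequences, this is a recursion for the number of Toeplitz matrices of determinant `b`
(`toeplitzCount_succ`), in which the extra factors can be normalized to `u ^ c`. Iterating it, that
number is `q ^ (n - 1)` times the sum over the compositions `(c_1, …, c_k)` of `n` of the number of
solutions of `u_1 ^ c_1 ⋯ u_k ^ c_k = b` (`toeplitzCount_eq_sum_composition`). A unimodular change
of variables and cyclicity of the group of units give
`(q - 1) ^ (k - 1) * g_b(gcd (c_1, …, c_k, q - 1))` solutions (`monomialCount_units_eq`), which is the composition formula. The divisor formula follows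
by Möbius inversion and the weighted count of compositions with all parts divisible by `d`
(`sum_composition_dvd`); for a generator, and for `b = 1`, the function `f_b` is the Möbius function
and Euler's function, respectively.
-/

namespace SchurProb

/-! ### Complete homogeneous sums in finitely many variables -/

/-- The complete homogeneous sum `h_k(x_0, …, x_{N-1})`, defined by
`h_k(x_0, …, x_N) = h_k(x_0, …, x_{N-1}) + x_N h_{k-1}(x_0, …, x_N)`. -/
def completeSum {R : Type*} [CommRing R] (x : ℕ → R) : ℕ → ℕ → R
  | 0, 0 => 1
  | 0, _ + 1 => 0
  | _ + 1, 0 => 1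
  | N + 1, k + 1 => completeSum x N (k + 1) + x N * completeSum x (N + 1) k

/-- The complete homogeneous sum with an integer index, zero for negative indices. -/
def completeSumInt {R : Type*} [CommRing R] (x : ℕ → R) (N : ℕ) (k : ℤ) : R :=
  if 0 ≤ k then completeSum x N k.toNat else 0

section

variable {R : Type*} [CommRing R] (x : ℕ → R)

theorem completeSum_zero_right (N : ℕ) : completeSum x N 0 = 1 := by
  cases N <;> rw [completeSum]

theorem map_completeSum {S : Type*} [CommRing S] (φ : R →+* S) (N k : ℕ) :
    φ (completeSum x N k) = completeSum (fun i => φ (x i)) N k := by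
  induction N generalizing k with
  | zero => cases k <;> simp [completeSum]
  | succ N ihN =>
    induction k with
    | zero => simp [completeSum]
    | succ k ihk => rw [completeSum, completeSum, map_add, map_mul, ihN, ihk]

theorem completeSumInt_natCast (N k : ℕ) : completeSumInt x N (k : ℤ) = completeSum x N k := by
  simp [completeSumInt]

theorem completeSumInt_of_neg (N : ℕ) {k : ℤ} (hk : k < 0) : completeSumInt x N k = 0 :=
  if_neg (by omega)

theorem completeSumInt_zero_left (k : ℤ) :
    completeSumInt x 0 k = if k = 0 then 1 else 0 := by
  rcases lt_or_ge k 0 with hk | hk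
  · rw [completeSumInt_of_neg x 0 hk, if_neg (by omega)]
  · lift k to ℕ using hk
    rw [completeSumInt_natCast]
    cases k with
    | zero => simp [completeSum]
    | succ k => rw [completeSum, if_neg (by omega)]

theorem completeSumInt_succ (N : ℕ) (k : ℤ) :
    completeSumInt x (N + 1) k = completeSumInt x N k + x N * completeSumInt x (N + 1) (k - 1) := by
  rcases lt_or_ge k 0 with hk | hk
  · simp [completeSumInt_of_neg, hk, show k - 1 < 0 by omega]
  · lift k to ℕ using hk
    cases k with
    | zero => simp [completeSumInt, completeSum_zero_right]
    | succ k =>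
      rw [completeSumInt_natCast, completeSumInt_natCast,
        show ((k + 1 : ℕ) : ℤ) - 1 = (k : ℤ) by omega, completeSumInt_natCast, completeSum]

theorem completeSumInt_add_natCast (N : ℕ) (k : ℤ) (d : ℕ) :
    completeSumInt x (N + 1) (k + d) = x N ^ d * completeSumInt x (N + 1) k +
      ∑ e ∈ Finset.range d, x N ^ e * completeSumInt x N (k + d - e) := by
  induction d with
  | zero => simp
  | succ d ih =>
    rw [completeSumInt_succ, show k + ((d + 1 : ℕ) : ℤ) - 1 = k + d by push_cast; ring, ih,
      Finset.sum_range_succ', mul_add, Finset.mul_sum]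
    have : ∀ e ∈ Finset.range d, x N * (x N ^ e * completeSumInt x N (k + d - e)) =
        x N ^ (e + 1) * completeSumInt x N (k + ((d + 1 : ℕ) : ℤ) - ((e + 1 : ℕ) : ℤ)) := by
      intro e _
      rw [show k + ((d + 1 : ℕ) : ℤ) - ((e + 1 : ℕ) : ℤ) = k + d - e by push_cast; ring]
      ring
    rw [Finset.sum_congr rfl this, pow_zero, one_mul, Nat.cast_zero, sub_zero]
    ring

/-- The interval form of the recursion: the gap between two rows of the Jacobi–Trudi matrix in
`N + 1` variables, in terms of `N` variables. -/
theorem completeSumInt_sub (N : ℕ) {a b : ℕ} (hba : b ≤ a) (t : ℤ) :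
    completeSumInt x (N + 1) (a + t) - x N ^ (a + 1 - b) * completeSumInt x (N + 1) (b - 1 + t) =
      ∑ m ∈ Finset.Icc b a, x N ^ (a - m) * completeSumInt x N (m + t) := by
  have h1 := completeSumInt_add_natCast x N (b - 1 + t) (a + 1 - b)
  rw [show (b : ℤ) - 1 + t + ((a + 1 - b : ℕ) : ℤ) = a + t by omega] at h1
  rw [h1, add_sub_cancel_left]
  refine Finset.sum_bij' (fun e _ => a - e) (fun m _ => a - m) ?_ ?_ ?_ ?_ ?_
  · intro e he; simp only [Finset.mem_range, Finset.mem_Icc] at *; omega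
  · intro e he; simp only [Finset.mem_range, Finset.mem_Icc] at *; omega
  · intro e he; simp only [Finset.mem_range] at *; omega
  · intro e he; simp only [Finset.mem_Icc] at *; omega
  · intro e he
    simp only [Finset.mem_range] at he
    rw [show a - (a - e) = e by omega, show ((a - e : ℕ) : ℤ) + t = a + t - e by omega]

/-! ### The Jacobi–Trudi determinant and removal of a variable -/

/-- The Jacobi–Trudi determinant `det (h_{m_i - i + j})` in the variables `x_0, …, x_{N-1}`. -/
def jacobiTrudi (N : ℕ) {n : ℕ} (m : Fin n → ℕ) : R :=
  (Matrix.of fun i j : Fin n => completeSumInt x N ((m i : ℤ) + ((j : ℤ) - (i : ℤ)))).det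

/-- Subtracting a multiple of the following row from each row does not change a determinant. -/
theorem det_sub_smul_next_row {n : ℕ} (A : ℕ → Fin n → R) (y : ℕ → R) (hA : A n = 0) :
    (Matrix.of fun i j : Fin n => A i j - y i * A (i + 1) j).det =
      (Matrix.of fun i j : Fin n => A i j).det := by
  let L : Matrix (Fin n) (Fin n) R := Matrix.of fun i k =>
    if k = i then 1 else if (k : ℕ) = i + 1 then - y i else 0
  have hL : L.det = 1 := by
    rw [Matrix.det_of_isUpperTriangular]
    · simp [L]
    · intro i j hij
      simp only [id] at hij
      simp only [L, Matrix.of_apply]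
      rw [if_neg (by omega), if_neg (by omega)]
  have hmul : (Matrix.of fun i j : Fin n => A i j - y i * A (i + 1) j) =
      L * Matrix.of fun i j : Fin n => A i j := by
    ext i j
    rw [Matrix.mul_apply, ← Finset.add_sum_erase _ _ (Finset.mem_univ i)]
    simp only [L, Matrix.of_apply, if_pos, one_mul, sub_eq_add_neg]
    congr 1
    by_cases hi : (i : ℕ) + 1 < n
    · rw [Finset.sum_eq_single ⟨i + 1, hi⟩]
      · rw [if_neg (by simp [Fin.ext_iff]), if_pos rfl, neg_mul]
      · intro k hk hk'
        rw [if_neg (Finset.ne_of_mem_erase hk), if_neg (fun hh => hk' (Fin.ext hh)), zero_mul]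
      · intro hh
        exact absurd (Finset.mem_erase.mpr ⟨by simp [Fin.ext_iff], Finset.mem_univ _⟩) hh
    · rw [show (i : ℕ) + 1 = n by omega, hA, Finset.sum_eq_zero]
      · simp
      · intro k hk
        rw [if_neg (Finset.ne_of_mem_erase hk), if_neg (by omega), zero_mul]
  rw [hmul, Matrix.det_mul, hL, one_mul]

/-- The sequences `m` with `l_{i+1} ≤ m_i ≤ l_i` for `i < n`: when `l` is a partition with at most
`n` parts, these are the partitions obtained from it by removing a horizontal strip. -/
def interlacing (n : ℕ) (l : ℕ → ℕ) : Finset (Fin n → ℕ) :=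
  Fintype.piFinset fun i : Fin n => Finset.Icc (l (i + 1)) (l i)

/-- Expanding the Jacobi–Trudi determinant in its last variable gives one term for each way of
removing a horizontal strip: after the row operations, row `i` is the sum of the rows with parts
between `l (i + 1)` and `l i`, and the determinant is multilinear in its rows. -/
theorem jacobiTrudi_succ (N n : ℕ) (l : ℕ → ℕ) (hl : Antitone l) (hn : l n = 0) :
    jacobiTrudi x (N + 1) (fun i : Fin n => l i) =
      ∑ m ∈ interlacing n l, (∏ i : Fin n, x N ^ (l i - m i)) * jacobiTrudi x N m := by
  have h1 := det_sub_smul_next_row (n := n)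
    (fun i j => completeSumInt x (N + 1) ((l i : ℤ) + ((j : ℤ) - (i : ℤ))))
    (fun i => x N ^ (l i + 1 - l (i + 1))) (by
      funext j
      exact completeSumInt_of_neg x _ (by rw [hn]; omega))
  rw [jacobiTrudi, ← h1]
  have h2 : (Matrix.of fun i j : Fin n =>
      completeSumInt x (N + 1) ((l i : ℤ) + ((j : ℤ) - (i : ℤ))) - x N ^ (l i + 1 - l (i + 1)) *
        completeSumInt x (N + 1) ((l (i + 1) : ℤ) + ((j : ℤ) - ((i + 1 : ℕ) : ℤ)))) =
      fun i : Fin n => ∑ m ∈ Finset.Icc (l (i + 1)) (l i), x N ^ (l i - m) •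
        fun j : Fin n => completeSumInt x N ((m : ℤ) + ((j : ℤ) - (i : ℤ))) := by
    ext i j
    rw [Finset.sum_apply]
    simp only [Matrix.of_apply, Pi.smul_apply, smul_eq_mul]
    rw [← completeSumInt_sub x N (hl (Nat.le_succ i)) ((j : ℤ) - (i : ℤ))]
    congr 3
    push_cast
    ring
  rw [h2]
  have h3 := (Matrix.detRowAlternating (n := Fin n) (R := R)).toMultilinearMap.map_sum_finset
    (fun (i : Fin n) (m : ℕ) => x N ^ (l i - m) •
        fun j : Fin n => completeSumInt x N ((m : ℤ) + ((j : ℤ) - (i : ℤ))))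
    (fun i => Finset.Icc (l (i + 1)) (l i))
  refine h3.trans (Finset.sum_congr rfl fun m _ => ?_)
  exact MultilinearMap.map_smul_univ _ _ _

theorem jacobiTrudi_zero_left (n : ℕ) (l : ℕ → ℕ) (hl : Antitone l) :
    jacobiTrudi x 0 (fun i : Fin n => l i) = if ∀ i : Fin n, l i = 0 then 1 else 0 := by
  rw [jacobiTrudi]
  simp only [completeSumInt_zero_left]
  split_ifs with h0
  · convert Matrix.det_one (n := Fin n) (R := R) using 2
    ext i j
    simp only [Matrix.of_apply, h0, Matrix.one_apply, Fin.ext_iff]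
    exact if_congr (by omega) rfl rfl
  · push Not at h0
    obtain ⟨i, hi⟩ := h0
    refine Matrix.det_eq_zero_of_row_eq_zero ⟨0, i.pos⟩ fun j => ?_
    have := hl (Nat.zero_le (i : ℕ))
    simp only [Matrix.of_apply]
    rw [if_neg (by omega)]

end

/-! ### Semistandard tableaux and removal of the largest entry -/

/-- The tableau `T` has all its entries smaller than `N`. -/
def EntriesLT {lam : YoungDiagram} (T : SemistandardYoungTableau lam) (N : ℕ) : Prop :=
  ∀ i j, (i, j) ∈ lam → T i j < N

instance finite_entriesLT (lam : YoungDiagram) (N : ℕ) :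
    Finite {T : SemistandardYoungTableau lam // EntriesLT T N} := by
  refine Finite.of_injective
    (fun (T : {T : SemistandardYoungTableau lam // EntriesLT T N}) (c : lam.cells) =>
      (⟨T.1 c.1.1 c.1.2, T.2 _ _ ((YoungDiagram.mem_cells _).mp c.2)⟩ : Fin N)) ?_
  intro T T' hT
  refine Subtype.ext (SemistandardYoungTableau.ext fun i j => ?_)
  by_cases hc : (i, j) ∈ lam
  · exact congrArg Fin.val (congrFun hT ⟨(i, j), hc⟩)
  · rw [T.1.zeros hc, T'.1.zeros hc]

noncomputable instance fintype_entriesLT (lam : YoungDiagram) (N : ℕ) :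
    Fintype {T : SemistandardYoungTableau lam // EntriesLT T N} :=
  Fintype.ofFinite _

/-- The weight `x^T` of a tableau. -/
def weight {R : Type*} [CommRing R] (x : ℕ → R) {lam : YoungDiagram}
    (T : SemistandardYoungTableau lam) : R :=
  ∏ c ∈ lam.cells, x (T c.1 c.2)

/-- The Schur polynomial in the variables `x_0, …, x_{N-1}`. -/
noncomputable def schurSum {R : Type*} [CommRing R] (x : ℕ → R) (N : ℕ) (lam : YoungDiagram) : R :=
  ∑ T : {T : SemistandardYoungTableau lam // EntriesLT T N}, weight x T.1

theorem card_cells_eq_sum_rowLen {lam : YoungDiagram} {n : ℕ} (hn : lam.rowLen n = 0) :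
    lam.cells.card = ∑ i : Fin n, lam.rowLen i := by
  rw [Finset.card_eq_sum_card_fiberwise (f := Prod.fst) (t := Finset.range n), Finset.sum_range]
  · exact Finset.sum_congr rfl fun i _ => lam.rowLen_eq_card.symm
  · intro c hc
    have h1 := YoungDiagram.mem_iff_lt_rowLen.mp ((YoungDiagram.mem_cells (μ := lam) c).mp hc)
    by_contra h2
    simp only [Finset.coe_range, Set.mem_Iio, not_lt] at h2
    have := lam.rowLen_anti _ _ h2
    omega

/-- Entries of a tableau on a smaller diagram; the cells outside it are set to zero. -/
def restrictTableau {lam : YoungDiagram} (T : SemistandardYoungTableau lam) (mu : YoungDiagram)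
    (hmu : mu ≤ lam) : SemistandardYoungTableau mu where
  entry i j := if (i, j) ∈ mu then T i j else 0
  row_weak' := by
    intro i j1 j2 hj hc
    rw [if_pos hc, if_pos (mu.up_left_mem le_rfl hj.le hc)]
    exact T.row_weak hj (hmu hc)
  col_strict' := by
    intro i1 i2 j hi hc
    rw [if_pos hc, if_pos (mu.up_left_mem hi.le le_rfl hc)]
    exact T.col_strict hi (hmu hc)
  zeros' := fun hc => if_neg hc

/-- Fill the cells of the horizontal strip `lam / mu` with the entry `N`, which is larger than all
the entries of `T`. -/
def extendTableau {mu : YoungDiagram} (T : SemistandardYoungTableau mu) (N : ℕ)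
    (hT : EntriesLT T N) (lam : YoungDiagram) (hmu : mu ≤ lam)
    (hstrip : ∀ i j, (i + 1, j) ∈ lam → (i, j) ∈ mu) : SemistandardYoungTableau lam where
  entry i j := if (i, j) ∈ mu then T i j else if (i, j) ∈ lam then N else 0
  row_weak' := by
    intro i j1 j2 hj hc
    by_cases h2 : (i, j2) ∈ mu
    · rw [if_pos h2, if_pos (mu.up_left_mem le_rfl hj.le h2)]
      exact T.row_weak hj h2
    · rw [if_neg h2, if_pos hc]
      split_ifs with h3
      · exact (hT _ _ h3).le
      · exact le_rfl
      · exact Nat.zero_le N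
  col_strict' := by
    intro i1 i2 j hi hc
    have h1 : (i1, j) ∈ mu := hstrip _ _ (lam.up_left_mem hi le_rfl hc)
    rw [if_pos h1]
    by_cases h2 : (i2, j) ∈ mu
    · rw [if_pos h2]
      exact T.col_strict hi h2
    · rw [if_neg h2, if_pos hc]
      exact hT _ _ h1
  zeros' := by
    intro i j hc
    rw [if_neg fun hh => hc (hmu hh), if_neg hc]

theorem restrictTableau_apply {lam : YoungDiagram} (T : SemistandardYoungTableau lam)
    (mu : YoungDiagram) (hmu : mu ≤ lam) (i j : ℕ) :
    restrictTableau T mu hmu i j = if (i, j) ∈ mu then T i j else 0 := rfl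

theorem extendTableau_apply {mu : YoungDiagram} (T : SemistandardYoungTableau mu) (N : ℕ)
    (hT : EntriesLT T N) (lam : YoungDiagram) (hmu : mu ≤ lam)
    (hstrip : ∀ i j, (i + 1, j) ∈ lam → (i, j) ∈ mu) (i j : ℕ) :
    extendTableau T N hT lam hmu hstrip i j =
      if (i, j) ∈ mu then T i j else if (i, j) ∈ lam then N else 0 := rfl

theorem weight_extendTableau {R : Type*} [CommRing R] (x : ℕ → R) {mu : YoungDiagram}
    (T : SemistandardYoungTableau mu) (N : ℕ) (hT : EntriesLT T N) (lam : YoungDiagram)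
    (hmu : mu ≤ lam) (hstrip : ∀ i j, (i + 1, j) ∈ lam → (i, j) ∈ mu) :
    weight x (extendTableau T N hT lam hmu hstrip) =
      x N ^ (lam.cells.card - mu.cells.card) * weight x T := by
  have hsub : mu.cells ⊆ lam.cells := YoungDiagram.cells_subset_iff.mpr hmu
  rw [weight, weight, ← Finset.prod_sdiff hsub, ← Finset.card_sdiff_of_subset hsub,
    ← Finset.prod_const]
  refine congrArg₂ _ (Finset.prod_congr rfl fun c hc => ?_) (Finset.prod_congr rfl fun c hc => ?_)
  · rw [Finset.mem_sdiff, YoungDiagram.mem_cells, YoungDiagram.mem_cells] at hc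
    rw [extendTableau_apply, if_neg hc.2, if_pos hc.1]
  · rw [YoungDiagram.mem_cells] at hc
    rw [extendTableau_apply, if_pos hc]

/-- The Young diagram with row lengths `m 0 ≥ m 1 ≥ …`. -/
def diagram {n : ℕ} (m : Fin n → ℕ) (hm : Antitone m) : YoungDiagram :=
  YoungDiagram.ofRowLens (List.ofFn m) (by simpa using hm)

theorem mem_diagram {n : ℕ} {m : Fin n → ℕ} {hm : Antitone m} {i j : ℕ} :
    (i, j) ∈ diagram m hm ↔ ∃ hi : i < n, j < m ⟨i, hi⟩ := by
  simp [diagram, YoungDiagram.mem_ofRowLens]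

theorem rowLen_diagram {n : ℕ} (m : Fin n → ℕ) (hm : Antitone m) (i : Fin n) :
    (diagram m hm).rowLen i = m i := by
  refine eq_of_forall_lt_iff fun j => ?_
  rw [← YoungDiagram.mem_iff_lt_rowLen, mem_diagram]
  exact ⟨fun ⟨_, hj⟩ => hj, fun hj => ⟨i.2, hj⟩⟩

theorem rowLen_diagram_self {n : ℕ} (m : Fin n → ℕ) (hm : Antitone m) :
    (diagram m hm).rowLen n = 0 := by
  by_contra hne
  have := YoungDiagram.mem_iff_lt_rowLen.mpr (Nat.pos_of_ne_zero hne)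
  rw [mem_diagram] at this
  exact absurd this.1 (lt_irrefl n)

theorem mem_interlacing {n : ℕ} {l : ℕ → ℕ} {m : Fin n → ℕ} :
    m ∈ interlacing n l ↔ ∀ i : Fin n, l (i + 1) ≤ m i ∧ m i ≤ l i := by
  simp [interlacing, Fintype.mem_piFinset]

theorem antitone_of_mem_interlacing {n : ℕ} {l : ℕ → ℕ} (hl : Antitone l) {m : Fin n → ℕ}
    (hm : m ∈ interlacing n l) : Antitone m := by
  rw [mem_interlacing] at hm
  intro i j hij
  rcases hij.eq_or_lt with rfl | hij
  · exact le_rfl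
  · exact (hm j).2.trans ((hl (Nat.succ_le_of_lt hij)).trans (hm i).1)

theorem diagram_le_of_mem_interlacing {n : ℕ} {lam : YoungDiagram} {m : Fin n → ℕ}
    (hm : m ∈ interlacing n lam.rowLen) (hm' : Antitone m) : diagram m hm' ≤ lam := by
  rintro ⟨i, j⟩ hc
  obtain ⟨hi, hj⟩ := mem_diagram.mp hc
  exact YoungDiagram.mem_iff_lt_rowLen.mpr (hj.trans_le (mem_interlacing.mp hm ⟨i, hi⟩).2)

theorem mem_diagram_of_succ_mem {n : ℕ} {lam : YoungDiagram} (hn : lam.rowLen n = 0)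
    {m : Fin n → ℕ} (hm : m ∈ interlacing n lam.rowLen) (hm' : Antitone m) (i j : ℕ)
    (hc : (i + 1, j) ∈ lam) : (i, j) ∈ diagram m hm' := by
  have h1 := YoungDiagram.mem_iff_lt_rowLen.mp hc
  have hi : i < n := by
    by_contra hi
    have := lam.rowLen_anti n (i + 1) (by omega)
    omega
  exact mem_diagram.mpr ⟨hi, h1.trans_le (mem_interlacing.mp hm ⟨i, hi⟩).1⟩

/-- A tableau with entries at most `N` is the same as a horizontal strip (the cells with entry
`N`) together with a tableau with entries smaller than `N` on the remaining diagram. -/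
theorem schurSum_succ {R : Type*} [CommRing R] (x : ℕ → R) (N n : ℕ) (lam : YoungDiagram)
    (hn : lam.rowLen n = 0) :
    schurSum x (N + 1) lam = ∑ m : {m : Fin n → ℕ // m ∈ interlacing n lam.rowLen},
      (∏ i : Fin n, x N ^ (lam.rowLen i - m.1 i)) *
        schurSum x N (diagram m.1 (antitone_of_mem_interlacing lam.rowLen_anti m.2)) := by
  have hanti : ∀ m : {m : Fin n → ℕ // m ∈ interlacing n lam.rowLen}, Antitone m.1 :=
    fun m => antitone_of_mem_interlacing lam.rowLen_anti m.2
  let Ψ : (Σ m : {m : Fin n → ℕ // m ∈ interlacing n lam.rowLen},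
      {T : SemistandardYoungTableau (diagram m.1 (hanti m)) // EntriesLT T N}) →
      {T : SemistandardYoungTableau lam // EntriesLT T (N + 1)} := fun p =>
    ⟨extendTableau p.2.1 N p.2.2 lam (diagram_le_of_mem_interlacing p.1.2 _)
      (mem_diagram_of_succ_mem hn p.1.2 _), by
      intro i j hc
      rw [extendTableau_apply]
      split_ifs with h1
      · exact (p.2.2 _ _ h1).trans (Nat.lt_succ_self N)
      · exact Nat.lt_succ_self N⟩
  have hΨ : ∀ p i j, (Ψ p).1 i j = if (i, j) ∈ diagram p.1.1 (hanti p.1) then p.2.1 i j else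
    if (i, j) ∈ lam then N else 0 := fun p i j => rfl
  have hle : ∀ m : {m : Fin n → ℕ // m ∈ interlacing n lam.rowLen},
    diagram m.1 (hanti m) ≤ lam := fun m => diagram_le_of_mem_interlacing m.2 _
  -- The smaller diagram consists of the cells of `lam` with entry less than `N`.
  have hmem : ∀ p i j, (i, j) ∈ diagram p.1.1 (hanti p.1) ↔ (i, j) ∈ lam ∧ (Ψ p).1 i j < N := by
    intro p i j
    rw [hΨ]
    constructor
    · intro hc
      rw [if_pos hc]
      exact ⟨hle p.1 hc, p.2.2 _ _ hc⟩
    · rintro ⟨hc, hlt⟩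
      by_contra hc'
      rw [if_neg hc', if_pos hc] at hlt
      exact lt_irrefl _ hlt
  have hbij : Function.Bijective Ψ := by
    constructor
    · rintro ⟨m, T⟩ ⟨m', T'⟩ heq
      have hmm : m = m' := by
        refine Subtype.ext (funext fun i => ?_)
        rw [← rowLen_diagram m.1 (hanti m) i, ← rowLen_diagram m'.1 (hanti m') i]
        refine eq_of_forall_lt_iff fun j => ?_
        rw [← YoungDiagram.mem_iff_lt_rowLen, ← YoungDiagram.mem_iff_lt_rowLen,
          hmem ⟨m, T⟩, hmem ⟨m', T'⟩, heq]
      subst hmm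
      have hTT : T = T' := by
        refine Subtype.ext (SemistandardYoungTableau.ext fun i j => ?_)
        by_cases hc : (i, j) ∈ diagram m.1 (hanti m)
        · have h1 := hΨ ⟨m, T⟩ i j
          have h2 := hΨ ⟨m, T'⟩ i j
          rw [if_pos hc] at h1 h2
          rw [← h1, ← h2, heq]
        · rw [T.1.zeros hc, T'.1.zeros hc]
      rw [hTT]
    · intro T
      have hlow : ∀ i, ∃ r, ∀ j, j < r ↔ ((i, j) ∈ lam ∧ T.1 i j < N) := by
        intro i
        have hex : ∃ r, ¬ ((i, r) ∈ lam ∧ T.1 i r < N) :=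
          ⟨lam.rowLen i, fun hh => lt_irrefl _ (YoungDiagram.mem_iff_lt_rowLen.mp hh.1)⟩
        refine ⟨Nat.find hex, fun j => ⟨fun hj => not_not.mp (Nat.find_min hex hj), fun hj => ?_⟩⟩
        by_contra hlt
        refine Nat.find_spec hex ⟨lam.up_left_mem le_rfl (not_lt.mp hlt) hj.1, ?_⟩
        exact (T.1.row_weak_of_le (not_lt.mp hlt) hj.1).trans_lt hj.2
      choose r hr using hlow
      have hm : (fun i : Fin n => r i) ∈ interlacing n lam.rowLen := by
        refine mem_interlacing.mpr fun i => ⟨?_, ?_⟩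
        · refine le_of_forall_lt fun j hj => (hr i j).mpr ?_
          have hc := YoungDiagram.mem_iff_lt_rowLen.mpr hj
          refine ⟨lam.up_left_mem (Nat.le_succ _) le_rfl hc, ?_⟩
          have h1 : T.1 i j < T.1 (i + 1) j := T.1.col_strict (Nat.lt_succ_self _) hc
          have h2 := T.2 _ _ hc
          omega
        · exact le_of_forall_lt fun j hj =>
            YoungDiagram.mem_iff_lt_rowLen.mp ((hr i j).mp hj).1
      have hmemr : ∀ i j, (i, j) ∈ diagram (fun i : Fin n => r i) (hanti ⟨_, hm⟩) ↔
          (i, j) ∈ lam ∧ T.1 i j < N := by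
        intro i j
        rw [mem_diagram, ← hr]
        refine ⟨fun ⟨_, hj⟩ => hj, fun hj => ⟨?_, hj⟩⟩
        by_contra hi
        have h1 := YoungDiagram.mem_iff_lt_rowLen.mp ((hr i j).mp hj).1
        have h2 := lam.rowLen_anti n i (by omega)
        omega
      refine ⟨⟨⟨_, hm⟩, restrictTableau T.1 _ (hle ⟨_, hm⟩), ?_⟩, ?_⟩
      · intro i j hc
        rw [restrictTableau_apply, if_pos hc]
        exact ((hmemr i j).mp hc).2
      · refine Subtype.ext (SemistandardYoungTableau.ext fun i j => ?_)
        rw [hΨ]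
        by_cases hc : (i, j) ∈ diagram (fun i : Fin n => r i) (hanti ⟨_, hm⟩)
        · rw [if_pos hc, restrictTableau_apply, if_pos hc]
        · rw [if_neg hc]
          rw [hmemr] at hc
          split_ifs with hc'
          · have h1 := T.2 _ _ hc'
            by_contra hne
            exact hc ⟨hc', by omega⟩
          · exact (T.1.zeros hc').symm
  rw [schurSum, ← hbij.sum_comp, Fintype.sum_sigma]
  refine Finset.sum_congr rfl fun m _ => ?_
  rw [schurSum, Finset.mul_sum]
  refine Finset.sum_congr rfl fun T _ => ?_
  rw [weight_extendTableau, card_cells_eq_sum_rowLen hn,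
    card_cells_eq_sum_rowLen (rowLen_diagram_self m.1 (hanti m)),
    Finset.prod_pow_eq_pow_sum, ← Finset.sum_tsub_distrib]
  · simp only [rowLen_diagram]
  · intro i _
    rw [rowLen_diagram]
    exact (mem_interlacing.mp m.2 i).2

theorem schurSum_zero_left {R : Type*} [CommRing R] (x : ℕ → R) (n : ℕ) (lam : YoungDiagram)
    (hn : lam.rowLen n = 0) :
    schurSum x 0 lam = if ∀ i : Fin n, lam.rowLen i = 0 then 1 else 0 := by
  split_ifs with h0
  · have hcard := card_cells_eq_sum_rowLen hn
    rw [Finset.sum_eq_zero fun i _ => h0 i, Finset.card_eq_zero] at hcard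
    have hno : ∀ c, c ∉ lam := fun c hc => by
      rw [← YoungDiagram.mem_cells, hcard] at hc
      simp at hc
    have : Unique {T : SemistandardYoungTableau lam // EntriesLT T 0} :=
      { default := ⟨SemistandardYoungTableau.highestWeight lam, fun i j hc => absurd hc (hno _)⟩
        uniq := fun T => Subtype.ext (SemistandardYoungTableau.ext fun i j => by
          rw [T.1.zeros (hno _), SemistandardYoungTableau.zeros _ (hno _)]) }
    rw [schurSum, Fintype.sum_unique, weight, hcard, Finset.prod_empty]
  · push Not at h0
    obtain ⟨i, hi⟩ := h0
    have hc := YoungDiagram.mem_iff_lt_rowLen.mpr (Nat.pos_of_ne_zero hi)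
    have : IsEmpty {T : SemistandardYoungTableau lam // EntriesLT T 0} :=
      ⟨fun T => absurd (T.2 _ _ hc) (Nat.not_lt_zero _)⟩
    rw [schurSum, Fintype.sum_empty]

/-- The Jacobi–Trudi identity in finitely many variables: both sides satisfy the same recursion in
the number of variables. -/
theorem schurSum_eq_jacobiTrudi {R : Type*} [CommRing R] (x : ℕ → R) (N n : ℕ)
    (lam : YoungDiagram) (hn : lam.rowLen n = 0) :
    schurSum x N lam = jacobiTrudi x N (fun i : Fin n => lam.rowLen i) := by
  induction N generalizing lam with
  | zero => rw [schurSum_zero_left x n lam hn, jacobiTrudi_zero_left x n _ lam.rowLen_anti]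
  | succ N ih =>
    rw [schurSum_succ x N n lam hn, jacobiTrudi_succ x N n _ lam.rowLen_anti hn,
      ← Finset.sum_coe_sort (interlacing n lam.rowLen)]
    refine Finset.sum_congr rfl fun m _ => ?_
    rw [ih _ (rowLen_diagram_self _ _)]
    simp only [rowLen_diagram]

/-! ### The Jacobi–Trudi identity for symmetric functions -/

theorem weight_X_eq_monomial_content {lam : YoungDiagram} (T : SemistandardYoungTableau lam) :
    weight (fun i => (MvPowerSeries.X i : MvPowerSeries ℕ ℤ)) T =
      MvPowerSeries.monomial (content T) 1 := by
  classical
  rw [weight, content]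
  induction lam.cells using Finset.induction_on with
  | empty => simp
  | insert c s hc ih =>
    rw [Finset.prod_insert hc, Finset.sum_insert hc, ih, MvPowerSeries.X,
      MvPowerSeries.monomial_mul_monomial, mul_one]

theorem entriesLT_of_content_support {lam : YoungDiagram} (T : SemistandardYoungTableau lam)
    {N : ℕ} (hT : ∀ i, N ≤ i → content T i = 0) : EntriesLT T N := by
  intro i j hc
  by_contra hN
  have h1 := hT _ (not_lt.mp hN)
  rw [content, Finsupp.finsetSum_apply, Finset.sum_eq_zero_iff] at h1
  have h2 := h1 (i, j) ((YoungDiagram.mem_cells _).mpr hc)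
  simp at h2

theorem embDomain_valEmbedding_apply_of_le {N : ℕ} (d : Fin N →₀ ℕ) {i : ℕ} (hi : N ≤ i) :
    d.embDomain Fin.valEmbedding i = 0 := by
  refine Finsupp.embDomain_of_notMem_range _ _ _ ?_
  rintro ⟨j, rfl⟩
  exact absurd j.2 (not_lt.mpr hi)

/-- Setting to zero all but the first `N` variables of a power series. -/
noncomputable def restrictVars (N : ℕ) : MvPowerSeries ℕ ℤ →+* MvPowerSeries (Fin N) ℤ :=
  (MvPowerSeries.killCompl (R := ℤ) (Fin.valEmbedding (n := N))).toRingHom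

theorem coeff_restrictVars (N : ℕ) (p : MvPowerSeries ℕ ℤ) (d : Fin N →₀ ℕ) :
    MvPowerSeries.coeff d (restrictVars N p) =
      MvPowerSeries.coeff (d.embDomain Fin.valEmbedding) p :=
  MvPowerSeries.coeff_killCompl p d

/-- A monomial involves finitely many variables, so a power series is determined by its
restrictions to finitely many variables. -/
theorem eq_of_restrictVars_eq {p p' : MvPowerSeries ℕ ℤ}
    (hp : ∀ N, restrictVars N p = restrictVars N p') : p = p' := by
  ext d
  obtain ⟨N, hN⟩ : ∃ N, ∀ i ∈ d.support, i < N :=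
    ⟨d.support.sup id + 1, fun i hi => Nat.lt_succ_of_le (Finset.le_sup (f := id) hi)⟩
  have hd : d ∈ Set.range (Finsupp.embDomain (M := ℕ) (Fin.valEmbedding (n := N))) := by
    rw [Finsupp.mem_range_embDomain_iff]
    intro i hi
    exact ⟨⟨i, hN i hi⟩, rfl⟩
  obtain ⟨e, rfl⟩ := hd
  rw [← coeff_restrictVars, hp, coeff_restrictVars]

theorem restrictVars_schur (N : ℕ) (lam : YoungDiagram) :
    restrictVars N (schur lam) = restrictVars N (schurSum MvPowerSeries.X N lam) := by
  classical
  ext d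
  rw [coeff_restrictVars, coeff_restrictVars, schurSum, map_sum]
  set d' := d.embDomain Fin.valEmbedding with hd'
  have h1 : ∀ T : {T : SemistandardYoungTableau lam // EntriesLT T N},
      MvPowerSeries.coeff d' (weight (fun i => (MvPowerSeries.X i : MvPowerSeries ℕ ℤ)) T.1) =
        if content T.1 = d' then 1 else 0 := by
    intro T
    rw [weight_X_eq_monomial_content, MvPowerSeries.coeff_monomial]
    exact if_congr eq_comm rfl rfl
  rw [Finset.sum_congr rfl fun T _ => h1 T, Finset.sum_boole, ← Fintype.card_subtype,
    ← Nat.card_eq_fintype_card]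
  change ((Nat.card _ : ℕ) : ℤ) = _
  congr 1
  refine Nat.card_congr ⟨fun T => ⟨⟨T.1, ?_⟩, T.2⟩, fun T => ⟨T.1.1, T.2⟩, fun _ => rfl,
    fun _ => rfl⟩
  refine entriesLT_of_content_support T.1 fun i hi => ?_
  rw [T.2, hd', embDomain_valEmbedding_apply_of_le d hi]

theorem coeff_X_mul' (i : ℕ) (p : MvPowerSeries ℕ ℤ) (d : ℕ →₀ ℕ) :
    MvPowerSeries.coeff d (MvPowerSeries.X i * p) =
      if d i = 0 then 0 else MvPowerSeries.coeff (d - Finsupp.single i 1) p := by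
  classical
  rw [MvPowerSeries.X, MvPowerSeries.coeff_monomial_mul, one_mul, ← ite_not]
  exact if_congr (by rw [Finsupp.single_le_iff, Nat.one_le_iff_ne_zero, not_not]) rfl rfl

open Classical in
theorem coeff_completeSum_X (N k : ℕ) (d : ℕ →₀ ℕ) :
    MvPowerSeries.coeff d (completeSum (fun i => (MvPowerSeries.X i : MvPowerSeries ℕ ℤ)) N k) =
      if (∀ i, N ≤ i → d i = 0) ∧ d.degree = k then 1 else 0 := by
  induction N generalizing k d with
  | zero =>
    have h0 : (∀ i, 0 ≤ i → d i = 0) ↔ d = 0 :=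
      ⟨fun hd => Finsupp.ext fun i => hd i (Nat.zero_le i), fun hd => by simp [hd]⟩
    cases k with
    | zero =>
      rw [completeSum, MvPowerSeries.coeff_one]
      refine if_congr ?_ rfl rfl
      rw [h0]
      exact ⟨fun hd => ⟨hd, by simp [hd]⟩, fun hd => hd.1⟩
    | succ k =>
      rw [completeSum, map_zero, if_neg]
      rintro ⟨h1, h2⟩
      rw [h0] at h1
      simp [h1] at h2
  | succ N ihN =>
    induction k generalizing d with
    | zero =>
      rw [completeSum, MvPowerSeries.coeff_one]
      refine if_congr ?_ rfl rfl
      rw [Finsupp.degree_eq_zero_iff]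
      exact ⟨fun hd => ⟨fun i _ => by simp [hd], hd⟩, fun hd => hd.2⟩
    | succ k ihk =>
      rw [completeSum, map_add, ihN, coeff_X_mul']
      by_cases hdN : d N = 0
      · rw [if_pos hdN, add_zero]
        refine if_congr (and_congr_left fun _ => ?_) rfl rfl
        refine ⟨fun hd i hi => hd i (by omega), fun hd i hi => ?_⟩
        rcases hi.eq_or_lt with rfl | hi
        · exact hdN
        · exact hd i hi
      · rw [if_neg hdN, if_neg (fun hh => hdN (hh.1 N le_rfl)), zero_add, ihk]
        have hle : Finsupp.single N 1 ≤ d := by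
          rw [Finsupp.single_le_iff]
          omega
        have hdeg : (d - Finsupp.single N 1).degree + 1 = d.degree := by
          conv_rhs => rw [← tsub_add_cancel_of_le hle, map_add, Finsupp.degree_single]
        refine if_congr (and_congr ?_ (by omega)) rfl rfl
        refine forall₂_congr fun i hi => ?_
        rw [Finsupp.tsub_apply, Finsupp.single_eq_of_ne (by omega), tsub_zero]

theorem restrictVars_h (N k : ℕ) :
    restrictVars N (h k : MvPowerSeries ℕ ℤ) =
      restrictVars N (completeSum (fun i => (MvPowerSeries.X i : MvPowerSeries ℕ ℤ)) N k) := by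
  classical
  ext d
  rw [coeff_restrictVars, coeff_restrictVars, coeff_completeSum_X]
  change (if (d.embDomain Fin.valEmbedding).degree = k then (1 : ℤ) else 0) = _
  exact if_congr (and_iff_right fun i hi => embDomain_valEmbedding_apply_of_le d hi).symm rfl rfl

theorem rowLen_rectangle (n a : ℕ) (i : ℕ) :
    (rectangle n a).rowLen i = if i < n then a else 0 := by
  refine eq_of_forall_lt_iff fun j => ?_
  rw [← YoungDiagram.mem_iff_lt_rowLen, rectangle, YoungDiagram.mem_ofRowLens]
  by_cases hi : i < n <;> simp [hi]

/-- The Jacobi–Trudi identity for the rectangle `(a^n)` with `n ≤ a`; under this hypothesis no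
index is negative. -/
theorem schur_rectangle_eq_det {n a : ℕ} (han : n ≤ a) :
    schur (rectangle n a) =
      (((Matrix.of fun i j : Fin n => h (a + j - i)).det : SymmetricFunctions) :
        MvPowerSeries ℕ ℤ) := by
  refine eq_of_restrictVars_eq fun N => ?_
  rw [restrictVars_schur, schurSum_eq_jacobiTrudi _ N n _ (by rw [rowLen_rectangle]; simp),
    jacobiTrudi]
  change _ = restrictVars N (SymmetricFunctions.subtype _)
  rw [RingHom.map_det, RingHom.map_det, RingHom.map_det]
  congr 1
  ext1 i j
  simp only [RingHom.mapMatrix_apply, Matrix.map_apply, Matrix.of_apply, Subring.subtype_apply]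
  rw [restrictVars_h, rowLen_rectangle, if_pos i.2, ← completeSumInt_natCast]
  congr 2
  omega

/-! ### Ring homomorphisms on symmetric functions in finitely many variables -/

/-- The variables `x_0, …, x_{N-1}` followed by zeros. -/
noncomputable def finVars (N : ℕ) (i : ℕ) : MvPolynomial (Fin N) ℤ :=
  if hi : i < N then MvPolynomial.X ⟨i, hi⟩ else 0

theorem coe_finVars (N i : ℕ) :
    (finVars N i : MvPowerSeries (Fin N) ℤ) = restrictVars N (MvPowerSeries.X i) := by
  rw [finVars]
  split_ifs with hi
  · rw [MvPolynomial.coe_X]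
    exact (MvPowerSeries.killCompl_X (e := Fin.valEmbedding) (⟨i, hi⟩ : Fin N)).symm
  · rw [MvPolynomial.coe_zero]
    refine (MvPowerSeries.killCompl_X_eq_zero ?_).symm
    rintro ⟨j, rfl⟩
    exact hi j.2

theorem coe_completeSum_finVars (N k : ℕ) :
    ((completeSum (finVars N) N k : MvPolynomial (Fin N) ℤ) : MvPowerSeries (Fin N) ℤ) =
      restrictVars N (h k : MvPowerSeries ℕ ℤ) := by
  rw [restrictVars_h, map_completeSum, ← MvPolynomial.coeToMvPowerSeries.ringHom_apply,
    map_completeSum]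
  simp only [MvPolynomial.coeToMvPowerSeries.ringHom_apply, coe_finVars]

/-- The restriction of a symmetric function to `N` variables is a polynomial, by boundedness of
the degree, and it is symmetric. -/
theorem exists_symmetric_restrictVars (N : ℕ) (f : SymmetricFunctions) :
    ∃ p : MvPolynomial (Fin N) ℤ, p.IsSymmetric ∧
      (p : MvPowerSeries (Fin N) ℤ) = restrictVars N (f : MvPowerSeries ℕ ℤ) := by
  obtain ⟨f, ⟨M, hM⟩, hf⟩ := f
  have hfin : (Function.support fun d : Fin N →₀ ℕ =>
      MvPowerSeries.coeff d (restrictVars N f)).Finite := by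
    refine (Finsupp.finite_of_degree_le (σ := Fin N) M).subset fun d hd => ?_
    by_contra hlt
    refine hd ?_
    change MvPowerSeries.coeff d (restrictVars N f) = 0
    rw [coeff_restrictVars]
    refine hM _ ?_
    rw [Finsupp.degree_apply, Finsupp.support_embDomain, Finset.sum_map]
    simp only [Finsupp.embDomain_apply_self]
    simpa [Finsupp.degree_apply] using hlt
  let p : MvPolynomial (Fin N) ℤ := ∑ d ∈ hfin.toFinset,
    MvPolynomial.monomial d (MvPowerSeries.coeff d (restrictVars N f))
  have hp : (p : MvPowerSeries (Fin N) ℤ) = restrictVars N f := by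
    classical
    ext d
    rw [MvPolynomial.coeff_coe, MvPolynomial.coeff_sum]
    simp only [MvPolynomial.coeff_monomial, Finset.sum_ite_eq', Set.Finite.mem_toFinset,
      Function.mem_support, ne_eq, ite_not, ite_eq_right_iff]
    exact Eq.symm
  refine ⟨p, fun σ => ?_, hp⟩
  apply MvPolynomial.coe_injective
  rw [← MvPowerSeries.rename_coe, hp]
  ext d
  obtain ⟨e, rfl⟩ : ∃ e : Fin N →₀ ℕ, e.embDomain σ.toEmbedding = d :=
    ⟨d.embDomain σ.symm.toEmbedding, by
      simp only [Finsupp.embDomain_eq_mapDomain, ← Finsupp.mapDomain_comp]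
      simp⟩
  have h1 := MvPowerSeries.coeff_embDomain_rename σ.toEmbedding (restrictVars N f) e
  refine h1.trans ?_
  -- Extend the permutation of the first `N` variables to all variables.
  let τ : Equiv.Perm ℕ := σ.extendDomain (Fin.equivSubtype (n := N))
  have h2 := MvPowerSeries.coeff_embDomain_rename τ.toEmbedding f
    (e.embDomain Fin.valEmbedding)
  have h3 : MvPowerSeries.rename τ.toEmbedding f = f := hf τ
  rw [coeff_restrictVars, coeff_restrictVars, ← h2, h3]
  simp only [Finsupp.embDomain_eq_mapDomain, ← Finsupp.mapDomain_comp]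
  refine congrArg (fun u => MvPowerSeries.coeff (Finsupp.mapDomain u e) f) (funext fun i => ?_)
  exact Equiv.Perm.extendDomain_apply_image σ (Fin.equivSubtype (n := N)) i

/-! ### Generating functions of elementary and complete sums -/

section Generating

open PowerSeries

variable {R : Type*} [CommRing R] (x : ℕ → R)

/-- The generating function identity `∏ (1 - x_i t) · ∑ h_k t^k = 1`. -/
theorem prod_mul_mk_completeSum (N : ℕ) :
    (∏ i ∈ Finset.range N, (1 - C (x i) * X)) * PowerSeries.mk (completeSum x N) = 1 := by
  induction N with
  | zero =>
    ext k
    cases k with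
    | zero => simp [completeSum]
    | succ k => simp [completeSum, PowerSeries.coeff_one]
  | succ N ih =>
    rw [Finset.prod_range_succ, mul_assoc]
    refine (congrArg _ ?_).trans ih
    ext k
    cases k with
    | zero => simp [completeSum_zero_right]
    | succ k =>
      rw [sub_mul, one_mul, map_sub, mul_assoc, coeff_C_mul, coeff_succ_X_mul, coeff_mk, coeff_mk,
        coeff_mk, completeSum, add_sub_cancel_right]

theorem coeff_prod_one_sub (N k : ℕ) (y : Fin N → R) :
    coeff k (∏ i, (1 - C (y i) * X : R⟦X⟧)) =
      (-1) ^ k * ∑ s ∈ Finset.powersetCard k Finset.univ, ∏ i ∈ s, y i := by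
  classical
  have h1 : ∏ i, (1 - C (y i) * X : R⟦X⟧) =
      ∑ s : Finset (Fin N), C ((-1) ^ s.card * ∏ i ∈ s, y i) * X ^ s.card := by
    simp only [sub_eq_add_neg, Finset.prod_one_add, Finset.powerset_univ]
    refine Finset.sum_congr rfl fun s _ => ?_
    rw [map_mul, map_prod, map_pow, map_neg, map_one, Finset.prod_neg, Finset.prod_mul_distrib,
      Finset.prod_const]
    ring
  rw [h1, map_sum, Finset.powersetCard_eq_filter, Finset.powerset_univ, Finset.sum_filter,
    Finset.mul_sum]
  refine Finset.sum_congr rfl fun s _ => ?_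
  rw [coeff_C_mul, coeff_X_pow]
  by_cases hs : s.card = k
  · rw [if_pos hs, if_pos hs.symm, mul_one, hs]
  · rw [if_neg hs, if_neg (Ne.symm hs), mul_zero, mul_zero]

/-- The coefficients of a power series up to a given degree determine those of its inverse. -/
theorem coeff_eq_of_mul_eq_one {A B A' B' : R⟦X⟧} (hAB : A * B = 1) (hAB' : A' * B' = 1) {N : ℕ}
    (hA : ∀ k ≤ N, coeff k A = coeff k A') : ∀ k ≤ N, coeff k B = coeff k B' := by
  have h1 : (X : R⟦X⟧) ^ (N + 1) ∣ B - B' := by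
    have h2 : (X : R⟦X⟧) ^ (N + 1) ∣ A' - A := by
      rw [X_pow_dvd_iff]
      intro m hm
      rw [map_sub, hA m (by omega), sub_self]
    have h3 : B - B' = B * B' * (A' - A) := by
      linear_combination B * hAB' * (-1) + B' * hAB
    rw [h3]
    exact h2.mul_left _
  intro k hk
  have h2 := X_pow_dvd_iff.mp h1 k (by omega)
  rwa [map_sub, sub_eq_zero] at h2

end Generating

/-! ### Existence of ring homomorphisms with prescribed values -/

open PowerSeries in
/-- Prescribing the values of `h_1, …, h_N` only: restrict to `N` variables and use that the
symmetric polynomials in `N` variables are freely generated by the elementary ones, whose values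
are read off from the inverse of the generating function of the prescribed values. -/
theorem exists_ringHom_apply_h_of_lt {F : Type*} [Field F] (c : ℕ → F) (N : ℕ) :
    ∃ φ : SymmetricFunctions →+* F, ∀ k < N, φ (h (k + 1)) = c k := by
  classical
  let A := MvPolynomial.symmetricSubalgebra (Fin N) ℤ
  choose p hp hpf using exists_symmetric_restrictVars N
  have hinj := MvPolynomial.coe_injective (σ := Fin N) (R := ℤ)
  let ρ : SymmetricFunctions →+* A :=
    { toFun := fun f => ⟨p f, hp f⟩
      map_one' := Subtype.ext (hinj (by rw [hpf]; simp))
      map_mul' := fun f f' => Subtype.ext (hinj (by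
        rw [hpf]
        simp only [MulMemClass.coe_mul, MvPolynomial.coe_mul, hpf, map_mul]))
      map_zero' := Subtype.ext (hinj (by rw [hpf]; simp))
      map_add' := fun f f' => Subtype.ext (hinj (by
        rw [hpf]
        simp only [AddMemClass.coe_add, MvPolynomial.coe_add, hpf, map_add])) }
  have hρ : ∀ k, (ρ (h k) : MvPolynomial (Fin N) ℤ) = completeSum (finVars N) N k := by
    intro k
    apply hinj
    rw [coe_completeSum_finVars]
    exact hpf _
  -- `D` is the generating function of the prescribed values, `D'` its inverse.
  let D : F⟦X⟧ := PowerSeries.mk fun k => Nat.casesOn k 1 c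
  have hD0 : constantCoeff D = 1 := by
    rw [← coeff_zero_eq_constantCoeff_apply, coeff_mk]
    rfl
  let D' : F⟦X⟧ := D⁻¹
  have hDD : D' * D = 1 := PowerSeries.inv_mul_cancel _ (by rw [hD0]; exact one_ne_zero)
  let θ : A →+* F :=
    (MvPolynomial.aeval (R := ℤ)
      (fun i : Fin N => (-1) ^ ((i : ℕ) + 1) * coeff ((i : ℕ) + 1) D')).toRingHom.comp
      (MvPolynomial.esymmAlgEquiv (Fin N) ℤ (Fintype.card_fin N)).symm.toRingEquiv.toRingHom
  let e : ℕ → A := fun k => ⟨MvPolynomial.esymm (Fin N) ℤ k,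
    MvPolynomial.esymm_isSymmetric (Fin N) ℤ k⟩
  have hθ : ∀ k ≤ N, θ (e k) = (-1) ^ k * coeff k D' := by
    intro k hk
    cases k with
    | zero =>
      have h1 : e 0 = 1 := Subtype.ext (MvPolynomial.esymm_zero (Fin N) ℤ)
      have h2 : coeff 0 D' = 1 := by
        rw [coeff_zero_eq_constantCoeff_apply]
        simp [D', hD0]
      rw [h1, map_one, h2, pow_zero, one_mul]
    | succ k =>
      have h1 := MvPolynomial.esymmAlgEquiv_symm_apply (R := ℤ) (Fintype.card_fin N)
        (⟨k, hk⟩ : Fin N)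
      change MvPolynomial.aeval _ ((MvPolynomial.esymmAlgEquiv (Fin N) ℤ _).symm (e (k + 1))) = _
      refine (congrArg _ h1).trans ?_
      rw [MvPolynomial.aeval_X]
  let E : A⟦X⟧ := PowerSeries.mk fun k => (-1) ^ k * e k
  let H : A⟦X⟧ := PowerSeries.mk fun k => ρ (h k)
  have hEH : E * H = 1 := by
    apply PowerSeries.map_injective A.val.toRingHom Subtype.val_injective
    rw [map_mul, map_one]
    have h1 : PowerSeries.map A.val.toRingHom H =
        PowerSeries.mk (completeSum (finVars N) N) := by
      ext1 k
      rw [coeff_map, coeff_mk, coeff_mk]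
      exact hρ k
    have h2 : PowerSeries.map A.val.toRingHom E =
        ∏ i ∈ Finset.range N, (1 - C (finVars N i) * X) := by
      rw [Finset.prod_range]
      ext1 k
      rw [coeff_map, coeff_mk, coeff_prod_one_sub, map_mul, map_pow, map_neg, map_one]
      congr 1
      change MvPolynomial.esymm (Fin N) ℤ k = _
      simp only [MvPolynomial.esymm, finVars, Fin.is_lt, dif_pos, Fin.eta]
    rw [h1, h2, prod_mul_mk_completeSum]
  have hEH' : PowerSeries.map θ E * PowerSeries.map θ H = 1 := by
    rw [← map_mul, hEH, map_one]
  have hcoeff := coeff_eq_of_mul_eq_one hEH' hDD (N := N) (by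
    intro k hk
    rw [coeff_map, coeff_mk, map_mul, map_pow, map_neg, map_one, hθ k hk, ← mul_assoc,
      ← mul_pow, neg_one_mul, neg_neg, one_pow, one_mul])
  refine ⟨θ.comp ρ, fun k hk => ?_⟩
  have h1 := hcoeff (k + 1) hk
  rw [coeff_map, coeff_mk, coeff_mk] at h1
  exact h1

/-- Every sequence in a finite field arises as the sequence of values of `h_1, h_2, …` under a ring
homomorphism. A limit along an ultrafilter of homomorphisms prescribed on `h_1, …, h_N` has the
required values; it exists because the field is finite. -/
theorem exists_ringHom_apply_h {F : Type*} [Field F] [Finite F] (c : ℕ → F) :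
    ∃ φ : SymmetricFunctions →+* F, ∀ k, φ (h (k + 1)) = c k := by
  choose φ hφ using exists_ringHom_apply_h_of_lt c
  let U : Ultrafilter ℕ := Filter.hyperfilter ℕ
  have hlim : ∀ f, ∃ b, ∀ᶠ N in (U : Filter ℕ), φ N f = b := by
    intro f
    exact Ultrafilter.eventually_exists_iff.mp (Filter.Eventually.of_forall fun N => ⟨_, rfl⟩)
  choose ψ hψ using hlim
  have huniq : ∀ {f b}, (∀ᶠ N in (U : Filter ℕ), φ N f = b) → ψ f = b := by
    intro f b hb
    obtain ⟨N, h1, h2⟩ := ((hψ f).and hb).exists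
    rw [← h1, h2]
  refine ⟨{ toFun := ψ, map_one' := ?_, map_mul' := ?_, map_zero' := ?_, map_add' := ?_ }, ?_⟩
  · exact huniq (Filter.Eventually.of_forall fun N => map_one _)
  · intro f f'
    refine huniq ?_
    filter_upwards [hψ f, hψ f'] with N h1 h2
    rw [map_mul, h1, h2]
  · exact huniq (Filter.Eventually.of_forall fun N => map_zero _)
  · intro f f'
    refine huniq ?_
    filter_upwards [hψ f, hψ f'] with N h1 h2
    rw [map_add, h1, h2]
  · intro k
    refine huniq ?_
    have hle : (U : Filter ℕ) ≤ Filter.atTop := Nat.hyperfilter_le_atTop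
    filter_upwards [hle (Filter.eventually_gt_atTop k)] with N hN
    exact hφ N k hN

/-! ### Complementary minors of triangular Toeplitz matrices -/

/-- Jacobi's identity for complementary minors: if `Y * Z = 1`, then the lower right block of `Y`
has determinant `det Y` times that of the upper left block of `Z`. -/
theorem det_toBlocks₂₂_of_mul_eq_one {R m n : Type*} [CommRing R] [Fintype m] [Fintype n]
    [DecidableEq m] [DecidableEq n] {Y Z : Matrix (m ⊕ n) (m ⊕ n) R} (hYZ : Y * Z = 1) :
    Y.toBlocks₂₂.det = Y.det * Z.toBlocks₁₁.det := by
  have h1 : Y * Matrix.fromBlocks Z.toBlocks₁₁ 0 Z.toBlocks₂₁ 1 =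
      Matrix.fromBlocks 1 Y.toBlocks₁₂ 0 Y.toBlocks₂₂ := by
    rw [← Matrix.fromBlocks_toBlocks Y, ← Matrix.fromBlocks_toBlocks Z,
      Matrix.fromBlocks_multiply, ← Matrix.fromBlocks_one, Matrix.fromBlocks_inj] at hYZ
    conv_lhs => rw [← Matrix.fromBlocks_toBlocks Y]
    rw [Matrix.fromBlocks_multiply, hYZ.1, hYZ.2.2.1]
    simp
  have h2 := congrArg Matrix.det h1
  rw [Matrix.det_mul, Matrix.det_fromBlocks_zero₁₂, Matrix.det_fromBlocks_zero₂₁, Matrix.det_one,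
    Matrix.det_one, mul_one, one_mul] at h2
  exact h2.symm

/-- The matrix of multiplication by `A` on power series modulo `X ^ N`. -/
noncomputable def mulMatrix {R : Type*} [CommRing R] (N : ℕ) (A : PowerSeries R) :
    Matrix (Fin N) (Fin N) R :=
  Matrix.of fun i j => if (j : ℕ) ≤ i then PowerSeries.coeff ((i : ℕ) - j) A else 0

theorem mulMatrix_mul {R : Type*} [CommRing R] (N : ℕ) (A B : PowerSeries R) :
    mulMatrix N A * mulMatrix N B = mulMatrix N (A * B) := by
  ext i j
  simp only [Matrix.mul_apply, mulMatrix, Matrix.of_apply, ite_mul, zero_mul, mul_ite, mul_zero]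
  rw [Finset.sum_fin_eq_sum_range, ← Finset.sum_filter_of_ne (p := fun k => (j : ℕ) ≤ k ∧ k ≤ i)]
  · split_ifs with hij
    · rw [PowerSeries.coeff_mul]
      symm
      refine Finset.sum_bij' (fun p _ => j + p.2) (fun k _ => ((i : ℕ) - k, k - (j : ℕ))) ?_ ?_ ?_
        ?_ ?_
      · intro p hp
        simp only [Finset.HasAntidiagonal.mem_antidiagonal, Finset.mem_filter,
          Finset.mem_range] at *
        omega
      · intro k hk
        simp only [Finset.HasAntidiagonal.mem_antidiagonal, Finset.mem_filter,
          Finset.mem_range] at *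
        omega
      · intro p hp
        simp only [Finset.HasAntidiagonal.mem_antidiagonal] at hp
        ext <;> simp only <;> omega
      · intro k hk
        simp only [Finset.mem_filter, Finset.mem_range] at hk
        omega
      · intro p hp
        simp only [Finset.HasAntidiagonal.mem_antidiagonal] at hp
        rw [dif_pos (by omega)]
        dsimp only
        rw [if_pos (by omega), if_pos (by omega)]
        congr 3 <;> omega
    · refine Finset.sum_eq_zero fun k hk => ?_
      simp only [Finset.mem_filter] at hk
      omega
  · intro k hk hne
    by_contra hcon
    refine hne ?_
    rw [dif_pos (Finset.mem_range.mp hk)]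
    dsimp only
    split_ifs with h1 h2
    · exact absurd ⟨h1, h2⟩ hcon
    · rfl
    · rfl

theorem mulMatrix_one {R : Type*} [CommRing R] (N : ℕ) :
    mulMatrix N (1 : PowerSeries R) = 1 := by
  ext i j
  rw [mulMatrix, Matrix.of_apply, PowerSeries.coeff_one, Matrix.one_apply]
  simp only [Fin.ext_iff]
  split_ifs <;> first | rfl | omega

theorem det_mulMatrix {R : Type*} [CommRing R] (N : ℕ) (A : PowerSeries R) :
    (mulMatrix N A).det = PowerSeries.coeff 0 A ^ N := by
  rw [Matrix.det_of_isLowerTriangular]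
  · simp [mulMatrix]
  · intro i j hij
    have : (i : ℕ) < j := hij
    rw [mulMatrix, Matrix.of_apply, if_neg (by omega)]

/-- A Toeplitz minor of a triangular Toeplitz matrix, in terms of the complementary minor of the
inverse matrix. The sign is that of a rotation by `m` places, hence trivial for even `m`. -/
theorem exists_sign_det_minor_eq (R : Type*) [CommRing R] (m n : ℕ) :
    ∃ ε : ℤˣ, (Even m → ε = 1) ∧ ∀ A B : PowerSeries R, A * B = 1 →
      (Matrix.of fun i j : Fin n => if (j : ℕ) ≤ m + i then
        PowerSeries.coeff (m + i - j) A else 0).det =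
      ((ε : ℤ) : R) * PowerSeries.coeff 0 A ^ (m + n) *
        (Matrix.of fun i j : Fin m => if (j : ℕ) ≤ n + i then
          PowerSeries.coeff (n + i - j) B else 0).det := by
  rcases Nat.eq_zero_or_pos (m + n) with h0 | h0
  · obtain ⟨rfl, rfl⟩ : m = 0 ∧ n = 0 := by omega
    exact ⟨1, fun _ => rfl, fun A B _ => by simp⟩
  have : NeZero (m + n) := ⟨h0.ne'⟩
  let e : Fin m ⊕ Fin n ≃ Fin (m + n) := finSumFinEquiv
  let σ : Equiv.Perm (Fin (m + n)) := (Equiv.addRight (Fin.ofNat (m + n) m)).symm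
  have hsymm : ∀ i j : Fin (m + n), (j : ℕ) = (i + m) % (m + n) → σ j = i := by
    intro i j hij
    rw [Equiv.symm_apply_eq]
    ext
    rw [hij]
    simp [Fin.val_add]
  have hσl : ∀ j : Fin m, ((σ (e (Sum.inl j)) : Fin (m + n)) : ℕ) = n + j := by
    intro j
    have := hsymm ⟨n + j, by omega⟩ (e (Sum.inl j)) (by
      simp only [e, finSumFinEquiv_apply_left, Fin.val_castAdd]
      rw [show n + (j : ℕ) + m = j + (m + n) by ring, Nat.add_mod_right,
        Nat.mod_eq_of_lt (by omega)])
    rw [this]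
  have hσr : ∀ j : Fin n, ((σ (e (Sum.inr j)) : Fin (m + n)) : ℕ) = j := by
    intro j
    have := hsymm ⟨j, by omega⟩ (e (Sum.inr j)) (by
      simp only [e, finSumFinEquiv_apply_right, Fin.val_natAdd]
      rw [Nat.mod_eq_of_lt (by omega), add_comm])
    rw [this]
  refine ⟨Equiv.Perm.sign σ, fun hm => ?_, fun A B hAB => ?_⟩
  · obtain ⟨k, rfl⟩ := hm
    have h1 : Equiv.addRight (Fin.ofNat (k + k + n) (k + k)) =
        Equiv.addRight (Fin.ofNat (k + k + n) k) * Equiv.addRight (Fin.ofNat (k + k + n) k) := by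
      ext i
      simp [Fin.val_add, add_assoc]
    rw [Equiv.Perm.sign_symm, h1, Equiv.Perm.sign_mul, Int.units_mul_self]
  · let Y := (mulMatrix (m + n) A).submatrix e (σ ∘ e)
    let Z := (mulMatrix (m + n) B).submatrix (σ ∘ e) e
    have hYZ : Y * Z = 1 := by
      have h1 := Matrix.submatrix_mul_equiv (mulMatrix (m + n) A) (mulMatrix (m + n) B) e
        (e.trans σ) e
      rw [mulMatrix_mul, hAB, mulMatrix_one, Matrix.submatrix_one_equiv] at h1
      exact h1
    have hY : Y.det = ((Equiv.Perm.sign σ : ℤ) : R) * PowerSeries.coeff 0 A ^ (m + n) := by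
      have h1 : Y = ((mulMatrix (m + n) A).submatrix id σ).submatrix e e := rfl
      rw [h1, Matrix.det_submatrix_equiv_self, Matrix.det_permute', det_mulMatrix]
    have h1 := det_toBlocks₂₂_of_mul_eq_one hYZ
    rw [hY] at h1
    convert h1 using 2
    · congr 1
      ext i j
      simp only [Y, Matrix.of_apply, Matrix.submatrix_apply, mulMatrix,
        Function.comp_apply, hσr]
      simp only [e, finSumFinEquiv_apply_right, Fin.val_natAdd]
      rfl
    · congr 1
      ext i j
      simp only [Matrix.toBlocks₁₁, Z, Matrix.of_apply, Matrix.submatrix_apply, mulMatrix,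
        Function.comp_apply, hσl]
      simp only [e, finSumFinEquiv_apply_left, Fin.val_castAdd]
      rfl

/-! ### Counting finite sequences -/

/-- The sequence with first term `u` followed by `s`. -/
def consSeq {F : Type*} (u : F) (s : ℕ → F) (k : ℕ) : F := Nat.casesOn k u s

/-- The sequence `s` preceded by `j` zeros. -/
def zerosSeq {F : Type*} [Field F] (j : ℕ) (s : ℕ → F) (k : ℕ) : F :=
  if k < j then 0 else s (k - j)

/-- A finite sequence continued by zeros. -/
def padSeq {F : Type*} [Field F] {N : ℕ} (s : Fin N → F) (k : ℕ) : F :=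
  if hk : k < N then s ⟨k, hk⟩ else 0

/-- The number of sequences with `N` terms satisfying `Q`. -/
noncomputable def seqCount {F : Type*} [Field F] (N : ℕ) (Q : (ℕ → F) → Prop) : ℕ :=
  Nat.card {s : Fin N → F // Q (padSeq s)}

section

variable {F : Type*} [Field F]

theorem padSeq_cons {N : ℕ} (u : F) (s : Fin N → F) :
    padSeq (Fin.cons u s : Fin (N + 1) → F) = consSeq u (padSeq s) := by
  funext k
  cases k with
  | zero => simp [padSeq, consSeq]
  | succ k =>
    by_cases hk : k < N
    · have h1 : (⟨k + 1, Nat.succ_lt_succ hk⟩ : Fin (N + 1)) = Fin.succ ⟨k, hk⟩ := rfl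
      simp only [padSeq, consSeq, hk, Nat.succ_lt_succ hk, dif_pos, h1, Fin.cons_succ]
    · simp [padSeq, consSeq, hk]

theorem zerosSeq_zero (s : ℕ → F) : zerosSeq 0 s = s := by
  funext k
  simp [zerosSeq]

theorem zerosSeq_consSeq_zero (j : ℕ) (s : ℕ → F) :
    zerosSeq j (consSeq 0 s) = zerosSeq (j + 1) s := by
  funext k
  rw [zerosSeq, zerosSeq]
  rcases lt_trichotomy k j with hk | rfl | hk
  · rw [if_pos hk, if_pos (by omega)]
  · rw [if_neg (lt_irrefl _), if_pos (by omega), Nat.sub_self]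
    rfl
  · rw [if_neg (by omega), if_neg (by omega), show k - j = (k - (j + 1)) + 1 by omega]
    rfl

theorem seqCount_congr {N : ℕ} {Q Q' : (ℕ → F) → Prop} (hQ : ∀ s, Q s ↔ Q' s) :
    seqCount N Q = seqCount N Q' := by
  rw [show Q = Q' from funext fun s => propext (hQ s)]

theorem seqCount_equiv {N : ℕ} {Q Q' : (ℕ → F) → Prop} (Φ : (Fin N → F) ≃ (Fin N → F))
    (hQ : ∀ s, Q (padSeq s) ↔ Q' (padSeq (Φ s))) : seqCount N Q = seqCount N Q' :=
  Nat.card_congr (Φ.subtypeEquiv hQ)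

theorem seqCount_false (N : ℕ) {Q : (ℕ → F) → Prop} (hQ : ∀ s, ¬ Q s) : seqCount N Q = 0 := by
  have : IsEmpty {s : Fin N → F // Q (padSeq s)} := ⟨fun s => hQ _ s.2⟩
  exact Nat.card_of_isEmpty

variable [Fintype F]

theorem seqCount_true (N : ℕ) {Q : (ℕ → F) → Prop} (hQ : ∀ s, Q s) :
    seqCount N Q = Fintype.card F ^ N := by
  rw [seqCount, Nat.card_congr (Equiv.subtypeUnivEquiv fun s => hQ _)]
  simp

theorem seqCount_succ (N : ℕ) (Q : (ℕ → F) → Prop) :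
    seqCount (N + 1) Q = ∑ u : F, seqCount N fun s => Q (consSeq u s) := by
  simp only [seqCount]
  rw [← Nat.card_sigma]
  refine Nat.card_congr ⟨fun s => ⟨s.1 0, Fin.tail s.1, ?_⟩, fun p => ⟨Fin.cons p.1 p.2.1, ?_⟩,
    ?_, ?_⟩
  · rw [← padSeq_cons, Fin.cons_self_tail]
    exact s.2
  · rw [padSeq_cons]
    exact p.2.2
  · intro s
    exact Subtype.ext (Fin.cons_self_tail s.1)
  · intro p
    rfl

theorem sum_eq_add_sum_units [Fintype Fˣ] {M : Type*} [AddCommMonoid M] (t : F → M) :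
    ∑ u, t u = t 0 + ∑ u : Fˣ, t u := by
  classical
  rw [Fintype.sum_eq_add_sum_subtype_ne t 0]
  congr 1
  exact (Equiv.sum_comp unitsEquivNeZero fun u : {u : F // u ≠ 0} => t u).symm

theorem seqCount_drop (c N : ℕ) (Q : (ℕ → F) → Prop) :
    seqCount (c + N) (fun s => Q fun k => s (c + k)) = Fintype.card F ^ c * seqCount N Q := by
  induction c with
  | zero => simp
  | succ c ih =>
    rw [show c + 1 + N = c + N + 1 by ring, seqCount_succ]
    have h1 : ∀ u : F, (seqCount (c + N) fun s => Q fun k => consSeq u s (c + 1 + k)) =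
        Fintype.card F ^ c * seqCount N Q := by
      intro u
      rw [← ih]
      refine seqCount_congr fun s => ?_
      have : (fun k => consSeq u s (c + 1 + k)) = fun k => s (c + k) := by
        funext k
        rw [show c + 1 + k = c + k + 1 by ring]
        rfl
      rw [this]
    rw [Finset.sum_congr rfl fun u _ => h1 u, Finset.sum_const, Finset.card_univ, smul_eq_mul]
    ring

/-- Sorting sequences by the position of the first nonzero term. -/
theorem seqCount_eq_sum_first_ne_zero [Fintype Fˣ] (N j : ℕ) (hj : j ≤ N) (Q : (ℕ → F) → Prop) :
    seqCount N Q = (∑ i ∈ Finset.range j, ∑ u : Fˣ,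
      seqCount (N - 1 - i) fun s => Q (zerosSeq i (consSeq (u : F) s))) +
        seqCount (N - j) fun s => Q (zerosSeq j s) := by
  induction j with
  | zero => simp [zerosSeq_zero]
  | succ j ih =>
    rw [ih (by omega), Finset.sum_range_succ, add_assoc, show N - j = N - (j + 1) + 1 by omega,
      seqCount_succ, sum_eq_add_sum_units, show N - 1 - j = N - (j + 1) by omega]
    simp only [zerosSeq_consSeq_zero]
    ring

end

/-! ### Counting Toeplitz matrices with given determinant -/

section

variable {F : Type*} [Field F]

/-- Inversion of power series with constant coefficient `u` modulo `X ^ (K + 1)`, in terms of the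
`K` coefficients after the constant one. -/
noncomputable def invCoeffs (K : ℕ) (u : F) (s : Fin K → F) (i : Fin K) : F :=
  PowerSeries.coeff ((i : ℕ) + 1) (PowerSeries.mk (consSeq u (padSeq s)))⁻¹

theorem mk_consSeq_mul_inv {u : F} (hu : u ≠ 0) (s : ℕ → F) :
    PowerSeries.mk (consSeq u s) * (PowerSeries.mk (consSeq u s))⁻¹ = 1 :=
  PowerSeries.mul_inv_cancel _ (by
    rw [← PowerSeries.coeff_zero_eq_constantCoeff_apply, PowerSeries.coeff_mk]
    exact hu)

theorem consSeq_padSeq_invCoeffs (K : ℕ) {u : F} (s : Fin K → F) {k : ℕ}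
    (hk : k ≤ K) : consSeq u⁻¹ (padSeq (invCoeffs K u s)) k =
      PowerSeries.coeff k (PowerSeries.mk (consSeq u (padSeq s)))⁻¹ := by
  cases k with
  | zero =>
    rw [PowerSeries.coeff_zero_eq_constantCoeff_apply, PowerSeries.constantCoeff_inv,
      ← PowerSeries.coeff_zero_eq_constantCoeff_apply, PowerSeries.coeff_mk]
    rfl
  | succ k =>
    change padSeq (invCoeffs K u s) k = _
    rw [padSeq, dif_pos (show k < K by omega), invCoeffs]

theorem invCoeffs_invCoeffs (K : ℕ) {u : F} (hu : u ≠ 0) (s : Fin K → F) :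
    invCoeffs K u⁻¹ (invCoeffs K u s) = s := by
  funext i
  have h1 := coeff_eq_of_mul_eq_one (mk_consSeq_mul_inv (inv_ne_zero hu) (padSeq (invCoeffs K u s)))
    ((mul_comm _ _).trans (mk_consSeq_mul_inv hu (padSeq s))) (N := K) (by
      intro k hk
      rw [PowerSeries.coeff_mk, consSeq_padSeq_invCoeffs K s hk])
  rw [invCoeffs, h1 _ i.2, PowerSeries.coeff_mk]
  change padSeq s i = _
  rw [padSeq, dif_pos i.2]

/-- Power series inversion as a permutation of the truncated coefficient sequences. -/
noncomputable def invCoeffsEquiv (K : ℕ) {u : F} (hu : u ≠ 0) : (Fin K → F) ≃ (Fin K → F) where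
  toFun := invCoeffs K u
  invFun := invCoeffs K u⁻¹
  left_inv := invCoeffs_invCoeffs K hu
  right_inv s := by
    have h1 := invCoeffs_invCoeffs K (inv_ne_zero hu) s
    rwa [inv_inv] at h1

/-- The `n × n` Toeplitz matrix whose diagonals are the first `2n - 1` terms of `s`. -/
def toeplitz (n : ℕ) (s : ℕ → F) : Matrix (Fin n) (Fin n) F :=
  Matrix.of fun i j => s (n - 1 + i - j)

/-- The number of `n × n` Toeplitz matrices with determinant `b`. -/
noncomputable def toeplitzCount (n : ℕ) (b : F) : ℕ :=
  seqCount (2 * n - 1) fun s => (toeplitz n s).det = b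

theorem toeplitzCount_pow_mul (n : ℕ) (b : F) (v : Fˣ) :
    toeplitzCount n ((v : F) ^ n * b) = toeplitzCount n b := by
  symm
  refine seqCount_equiv (MulAction.toPerm v) fun s => ?_
  have h1 : toeplitz n (padSeq (v • s)) = (v : F) • toeplitz n (padSeq s) := by
    ext i j
    simp only [toeplitz, padSeq, Matrix.of_apply, Matrix.smul_apply, Pi.smul_apply, smul_eq_mul,
      Units.smul_def, mul_dite, mul_zero]
  rw [MulAction.toPerm_apply, h1, Matrix.det_smul, Fintype.card_fin]
  exact (mul_right_inj' (pow_ne_zero n v.ne_zero)).symm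

/-- If the first `n` terms vanish, so does the first row. -/
theorem det_toeplitz_zerosSeq_self {n : ℕ} (hn : 1 ≤ n) (s : ℕ → F) :
    (toeplitz n (zerosSeq n s)).det = 0 := by
  refine Matrix.det_eq_zero_of_row_eq_zero ⟨0, hn⟩ fun j => ?_
  rw [toeplitz, Matrix.of_apply, zerosSeq, if_pos]
  simp only
  omega

variable [Fintype F]

/-- The Toeplitz matrices of size `n = m + c` whose sequence starts with `c - 1` zeros followed by
`u ≠ 0`. Passing to the inverse power series replaces the determinant by a Toeplitz determinant of
size `m`, up to a factor; the factor can be changed by `m`-th powers of units because of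
`toeplitzCount_pow_mul`, which brings it to the form `u ^ c`. -/
theorem seqCount_toeplitz_zerosSeq {m c : ℕ} (hm : 1 ≤ m) (hc : 1 ≤ c) (u : Fˣ) (b : F) :
    (seqCount (2 * (m + c) - 1 - c) fun s =>
      (toeplitz (m + c) (zerosSeq (c - 1) (consSeq (u : F) s))).det = b) =
      Fintype.card F ^ c * toeplitzCount m (((u : F) ^ c)⁻¹ * b) := by
  obtain ⟨ε, hε, hJ⟩ := exists_sign_det_minor_eq F m (m + c)
  -- Both `ε ^ m = ε` and `ε * ε = 1` hold, so the sign can be absorbed into an `m`-th power.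
  have hεm : ((ε : ℤ) : F) ^ m = ((ε : ℤ) : F) := by
    rcases Nat.even_or_odd m with hm' | hm'
    · simp [hε hm']
    · rcases Int.units_eq_one_or ε with rfl | rfl
      · simp
      · simp [hm'.neg_one_pow]
  have hεε : ((ε : ℤ) : F) * ((ε : ℤ) : F) = 1 := by
    rcases Int.units_eq_one_or ε with rfl | rfl <;> simp
  set K := 2 * (m + c) - 1 - c with hK
  have hKc : K = c + (2 * m - 1) := by omega
  have hdet : ∀ s : Fin K → F,
      (toeplitz (m + c) (zerosSeq (c - 1) (consSeq (u : F) (padSeq s)))).det =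
        ((ε : ℤ) : F) * (u : F) ^ (m + (m + c)) *
          (toeplitz m fun k => padSeq (invCoeffs K (u : F) s) (c + k)).det := by
    intro s
    have h1 := hJ _ _ (mk_consSeq_mul_inv u.ne_zero (padSeq s))
    rw [PowerSeries.coeff_mk] at h1
    have hL : toeplitz (m + c) (zerosSeq (c - 1) (consSeq (u : F) (padSeq s))) =
        Matrix.of fun i j : Fin (m + c) => if (j : ℕ) ≤ m + i then PowerSeries.coeff (m + i - j)
          (PowerSeries.mk (consSeq (u : F) (padSeq s))) else 0 := by
      ext i j
      rw [toeplitz, Matrix.of_apply, Matrix.of_apply, zerosSeq, PowerSeries.coeff_mk]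
      by_cases hij : (j : ℕ) ≤ m + i
      · rw [if_neg (by omega), if_pos hij,
          show m + c - 1 + (i : ℕ) - j - (c - 1) = m + i - j by omega]
      · rw [if_pos (by omega), if_neg hij]
    have hR : (toeplitz m fun k => padSeq (invCoeffs K (u : F) s) (c + k)) =
        Matrix.of fun i j : Fin m => if (j : ℕ) ≤ m + c + i then PowerSeries.coeff (m + c + i - j)
          (PowerSeries.mk (consSeq (u : F) (padSeq s)))⁻¹ else 0 := by
      ext i j
      rw [toeplitz, Matrix.of_apply, Matrix.of_apply, if_pos (by omega),
        ← consSeq_padSeq_invCoeffs K s (by omega),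
        show m + c + (i : ℕ) - j = c + (m - 1 + i - j) + 1 by omega]
      rfl
    rw [hL, h1, hR]
    rfl
  have hQ : ∀ t, ((ε : ℤ) : F) * (u : F) ^ (m + (m + c)) * (toeplitz m t).det = b ↔
      (toeplitz m t).det = ((ε : ℤ) : F) * ((u : F) ^ (m + (m + c)))⁻¹ * b := by
    intro t
    have hu : (u : F) ^ (m + (m + c)) ≠ 0 := pow_ne_zero _ u.ne_zero
    constructor
    · rintro rfl
      field_simp
      linear_combination (- (toeplitz m t).det) * hεε
    · intro ht
      rw [ht]
      field_simp
      linear_combination b * hεε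
  let v : Fˣ := ⟨((ε : ℤ) : F), ((ε : ℤ) : F), hεε, hεε⟩ * u ^ 2
  have hv : (v : F) ^ m * (((ε : ℤ) : F) * ((u : F) ^ (m + (m + c)))⁻¹ * b) =
      ((u : F) ^ c)⁻¹ * b := by
    have hu : (u : F) ≠ 0 := u.ne_zero
    have h1 : (v : F) ^ m = ((ε : ℤ) : F) * (u : F) ^ (2 * m) := by
      simp only [v, Units.val_mul, Units.val_pow_eq_pow_val, mul_pow, hεm, pow_mul]
    rw [h1, show m + (m + c) = 2 * m + c by ring, pow_add]
    field_simp
    linear_combination b * hεε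
  rw [seqCount_equiv (invCoeffsEquiv K u.ne_zero)
    (Q' := fun t => ((ε : ℤ) : F) * (u : F) ^ (m + (m + c)) *
      (toeplitz m fun k => t (c + k)).det = b) (fun s => by rw [hdet]; rfl), hKc,
    seqCount_drop c (2 * m - 1) (fun t => ((ε : ℤ) : F) * (u : F) ^ (m + (m + c)) *
      (toeplitz m t).det = b), seqCount_congr hQ, ← hv, toeplitzCount_pow_mul]
  rfl

/-- The Toeplitz matrices of size `n` whose sequence starts with `n - 1` zeros are triangular. -/
theorem seqCount_toeplitz_zerosSeq_self {n : ℕ} (hn : 1 ≤ n) (u : Fˣ) (b : F) [DecidableEq F] :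
    (seqCount (2 * n - 1 - n) fun s =>
      (toeplitz n (zerosSeq (n - 1) (consSeq (u : F) s))).det = b) =
      Fintype.card F ^ (n - 1) * if (u : F) ^ n = b then 1 else 0 := by
  have hdet : ∀ s, (toeplitz n (zerosSeq (n - 1) (consSeq (u : F) s))).det = (u : F) ^ n := by
    intro s
    rw [Matrix.det_of_isLowerTriangular]
    · simp [toeplitz, zerosSeq, consSeq]
    · intro i j hij
      have : (i : ℕ) < j := hij
      rw [toeplitz, Matrix.of_apply, zerosSeq, if_pos (by omega)]
  simp only [hdet]
  split_ifs with hb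
  · rw [seqCount_true _ fun _ => hb, mul_one, show 2 * n - 1 - n = n - 1 by omega]
  · rw [seqCount_false _ fun _ => hb, mul_zero]

/-- The recursion for the number of Toeplitz matrices of nonzero determinant, according to the
position and the value of the first nonzero term. -/
theorem toeplitzCount_succ [Fintype Fˣ] [DecidableEq F] (n : ℕ) {b : F} (hb : b ≠ 0) :
    toeplitzCount (n + 1) b = (∑ i ∈ Finset.range n, ∑ u : Fˣ,
      Fintype.card F ^ (i + 1) * toeplitzCount (n - i) (((u : F) ^ (i + 1))⁻¹ * b)) +
        ∑ u : Fˣ, Fintype.card F ^ n * if (u : F) ^ (n + 1) = b then 1 else 0 := by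
  rw [toeplitzCount, seqCount_eq_sum_first_ne_zero (2 * (n + 1) - 1) (n + 1) (by omega),
    seqCount_false (2 * (n + 1) - 1 - (n + 1)), add_zero, Finset.sum_range_succ]
  · refine congrArg₂ _ (Finset.sum_congr rfl fun i hi => Finset.sum_congr rfl fun u _ => ?_)
      (Finset.sum_congr rfl fun u _ => ?_)
    · have hin := Finset.mem_range.mp hi
      have h1 := seqCount_toeplitz_zerosSeq (m := n - i) (c := i + 1) (by omega) (by omega) u b
      rw [show n - i + (i + 1) = n + 1 by omega, Nat.add_sub_cancel] at h1
      rw [← h1, show 2 * (n + 1) - 1 - 1 - i = 2 * (n + 1) - 1 - (i + 1) by omega]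
    · have h1 := seqCount_toeplitz_zerosSeq_self (n := n + 1) (by omega) u b
      rw [Nat.add_sub_cancel] at h1
      rw [← h1, show 2 * (n + 1) - 1 - 1 - n = 2 * (n + 1) - 1 - (n + 1) by omega]
  · intro s hs
    exact hb (by rw [← hs, det_toeplitz_zerosSeq_self (by omega)])

end

/-! ### Sums over compositions -/

theorem sum_composition_succ {M : Type*} [AddCommMonoid M] (n : ℕ) (t : List ℕ → M) :
    ∑ c : Composition (n + 1), t c.blocks =
      ∑ i ∈ Finset.range (n + 1), ∑ c : Composition (n - i), t ((i + 1) :: c.blocks) := by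
  rw [Finset.sum_range fun i => ∑ c : Composition (n - i), t ((i + 1) :: c.blocks),
    ← Fintype.sum_sigma' (fun (i : Fin (n + 1)) (c : Composition (n - i)) =>
      t (((i : ℕ) + 1) :: c.blocks))]
  symm
  let Ψ : (Σ i : Fin (n + 1), Composition (n - i)) → Composition (n + 1) := fun p =>
    { blocks := ((p.1 : ℕ) + 1) :: p.2.blocks
      blocks_pos := by
        intro k hk
        rcases List.mem_cons.mp hk with rfl | hk
        · exact Nat.succ_pos _
        · exact p.2.blocks_pos hk
      blocks_sum := by
        have := p.1.2
        rw [List.sum_cons, p.2.blocks_sum]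
        omega }
  have hbij : Function.Bijective Ψ := by
    constructor
    · rintro ⟨i, c⟩ ⟨i', c'⟩ heq
      have h1 := congrArg Composition.blocks heq
      simp only [Ψ, List.cons.injEq] at h1
      obtain rfl : i = i' := Fin.ext (by omega)
      rw [Composition.ext h1.2]
    · intro c
      obtain ⟨k, l, hkl⟩ := List.exists_cons_of_ne_nil
        (fun hnil => absurd (c.blocks_eq_nil.mp hnil) (Nat.succ_ne_zero n))
      have hpos : ∀ {i}, i ∈ k :: l → 0 < i := fun hi => c.blocks_pos (by rw [hkl]; exact hi)
      have hsum := c.blocks_sum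
      rw [hkl, List.sum_cons] at hsum
      have hk := hpos (List.mem_cons_self (a := k) (l := l))
      refine ⟨⟨⟨k - 1, by omega⟩, ⟨l, fun hi => hpos (List.mem_cons_of_mem _ hi), by
        simp only; omega⟩⟩, Composition.ext ?_⟩
      simp only [Ψ, hkl, List.cons.injEq, and_true]
      omega
  exact hbij.sum_comp fun c => t c.blocks

theorem sum_composition_of_eq_zero {M : Type*} [AddCommMonoid M] {n : ℕ} (hn : n = 0)
    (t : List ℕ → M) : ∑ c : Composition n, t c.blocks = t [] := by
  subst hn
  rw [Finset.sum_congr rfl fun c _ => by rw [c.blocks_eq_nil.mpr rfl], Finset.sum_const,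
    Finset.card_univ, composition_card]
  simp

/-- The weighted number of compositions of `n` into parts divisible by `d`, for `n ≥ 1`. -/
theorem sum_composition_dvd {R : Type*} [CommRing R] (x : R) {d : ℕ} (hd : 0 < d) {n : ℕ}
    (hn : 0 < n) :
    (∑ c : Composition n, if ∀ k ∈ c.blocks, d ∣ k then x ^ c.length else 0) =
      if d ∣ n then x * (x + 1) ^ (n / d - 1) else 0 := by
  let t : List ℕ → R := fun l => if ∀ k ∈ l, d ∣ k then x ^ l.length else 0
  let A : ℕ → R := fun n => ∑ c : Composition n, t c.blocks
  have hA0 : A 0 = 1 := by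
    change ∑ c : Composition 0, t c.blocks = 1
    rw [sum_composition_of_eq_zero rfl]
    simp [t]
  have hrec : ∀ n, A (n + 1) = ∑ i ∈ Finset.range (n + 1),
      if d ∣ i + 1 then x * A (n - i) else 0 := by
    intro n
    simp only [A]
    rw [sum_composition_succ]
    refine Finset.sum_congr rfl fun i _ => ?_
    split_ifs with hi
    · rw [Finset.mul_sum]
      refine Finset.sum_congr rfl fun c _ => ?_
      simp only [t, List.forall_mem_cons, hi, true_and, List.length_cons, pow_succ', mul_ite,
        mul_zero]
    · exact Finset.sum_eq_zero fun c _ => if_neg fun hh => hi (hh _ List.mem_cons_self)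
  have hstep : ∀ n, A (n + 1 + d) = (x + 1) * A (n + 1) := by
    intro n
    obtain ⟨e, rfl⟩ : ∃ e, d = e + 1 := ⟨d - 1, by omega⟩
    rw [show n + 1 + (e + 1) = (n + 1 + e) + 1 by ring, hrec,
      show n + 1 + e + 1 = e + 1 + (n + 1) by ring, Finset.sum_range_add, add_mul, one_mul]
    congr 1
    · rw [Finset.sum_range_succ, if_pos dvd_rfl, Finset.sum_eq_zero, zero_add,
        Nat.add_sub_cancel]
      intro i hi
      rw [if_neg]
      intro hdvd
      have := Nat.le_of_dvd (Nat.succ_pos i) hdvd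
      have := Finset.mem_range.mp hi
      omega
    · rw [hrec]
      refine Finset.sum_congr rfl fun i _ => ?_
      rw [show e + 1 + i + 1 = e + 1 + (i + 1) by ring,
        show n + 1 + e - (e + 1 + i) = n - i by omega]
      exact if_congr (Nat.dvd_add_right dvd_rfl) rfl rfl
  change A n = _
  induction n using Nat.strong_induction_on with
  | _ n ih =>
    rcases lt_trichotomy n d with hnd | rfl | hnd
    · obtain ⟨n, rfl⟩ : ∃ k, n = k + 1 := ⟨n - 1, by omega⟩
      rw [if_neg (fun hh => absurd (Nat.le_of_dvd hn hh) (by omega)), hrec]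
      refine Finset.sum_eq_zero fun i hi => if_neg fun hh => ?_
      have := Nat.le_of_dvd (Nat.succ_pos i) hh
      have := Finset.mem_range.mp hi
      omega
    · obtain ⟨n, rfl⟩ : ∃ k, n = k + 1 := ⟨n - 1, by omega⟩
      rw [if_pos dvd_rfl, hrec, Finset.sum_range_succ, if_pos dvd_rfl, Nat.sub_self, hA0,
        Nat.div_self hn, Nat.sub_self, pow_zero, Finset.sum_eq_zero, zero_add]
      intro i hi
      refine if_neg fun hh => ?_
      have := Nat.le_of_dvd (Nat.succ_pos i) hh
      have := Finset.mem_range.mp hi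
      omega
    · obtain ⟨k, rfl⟩ : ∃ k, n = k + 1 + d := ⟨n - d - 1, by omega⟩
      rw [hstep, ih (k + 1) (by omega) (Nat.succ_pos k)]
      by_cases hk : d ∣ k + 1
      · have h1 : 0 < (k + 1) / d := Nat.div_pos (Nat.le_of_dvd (Nat.succ_pos k) hk) hd
        rw [if_pos hk, if_pos (hk.add dvd_rfl), Nat.add_div_right _ hd, Nat.succ_sub_one,
          ← Nat.sub_add_cancel h1, Nat.add_sub_cancel]
        ring
      · rw [if_neg hk, if_neg (fun hh => hk ((Nat.dvd_add_left dvd_rfl).mp hh)), mul_zero]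

/-! ### Solutions of monomial equations in a finite commutative group -/

section

variable {G : Type*} [CommGroup G] [Fintype G] [DecidableEq G]

/-- The number of solutions `(u_1, …, u_k)` of the equation `u_1 ^ c_1 * ⋯ * u_k ^ c_k = b`. -/
def monomialCount : List ℕ → G → ℕ
  | [], b => if b = 1 then 1 else 0
  | c :: l, b => ∑ u : G, monomialCount l ((u ^ c)⁻¹ * b)

/-- A unimodular change of variables turns `u ^ c * v ^ d` into a power with exponent
`gcd c d`. -/
theorem sum_card_pow_eq (c : ℕ) {d : ℕ} (hd : 0 < d) (b : G) :
    ∑ u : G, (Finset.univ.filter fun v : G => v ^ d = (u ^ c)⁻¹ * b).card =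
      Fintype.card G * (Finset.univ.filter fun w : G => w ^ Nat.gcd c d = b).card := by
  set k := Nat.gcd c d with hk
  have hk0 : 0 < k := Nat.gcd_pos_of_pos_right c hd
  obtain ⟨c', hc'⟩ := Nat.gcd_dvd_left c d
  obtain ⟨d', hd'⟩ := Nat.gcd_dvd_right c d
  rw [← hk] at hc' hd'
  obtain ⟨y, z, hyz⟩ : ∃ y z : ℤ, (c' : ℤ) * y + d' * z = 1 := by
    have h1 : (k : ℤ) = c * Nat.gcdA c d + d * Nat.gcdB c d := Nat.gcd_eq_gcd_ab c d
    have h2 : (c : ℤ) = k * c' := by exact_mod_cast hc'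
    have h3 : (d : ℤ) = k * d' := by exact_mod_cast hd'
    refine ⟨Nat.gcdA c d, Nat.gcdB c d,
      mul_left_cancel₀ (show (k : ℤ) ≠ 0 by exact_mod_cast hk0.ne') ?_⟩
    linear_combination -h1 - Nat.gcdA c d * h2 - Nat.gcdB c d * h3
  -- The exponent matrix has determinant `c' * y + d' * z = 1`, so it is invertible over `ℤ`.
  let Φ : G × G ≃ G × G :=
    { toFun := fun p => (p.1 ^ (c' : ℤ) * p.2 ^ (d' : ℤ), p.1 ^ (-z) * p.2 ^ y)
      invFun := fun p => (p.1 ^ y * p.2 ^ (-(d' : ℤ)), p.1 ^ z * p.2 ^ (c' : ℤ))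
      left_inv := by
        rintro ⟨u, v⟩
        ext
        · simp only [mul_zpow, ← zpow_mul]
          rw [mul_mul_mul_comm, ← zpow_add, ← zpow_add,
            show (c' : ℤ) * y + -z * -(d' : ℤ) = 1 by linear_combination hyz,
            show (d' : ℤ) * y + y * -(d' : ℤ) = 0 by ring, zpow_one, zpow_zero, mul_one]
        · simp only [mul_zpow, ← zpow_mul]
          rw [mul_mul_mul_comm, ← zpow_add, ← zpow_add,
            show (d' : ℤ) * z + y * (c' : ℤ) = 1 by linear_combination hyz,
            show (c' : ℤ) * z + -z * (c' : ℤ) = 0 by ring, zpow_one, zpow_zero, one_mul]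
      right_inv := by
        rintro ⟨u, v⟩
        ext
        · simp only [mul_zpow, ← zpow_mul]
          rw [mul_mul_mul_comm, ← zpow_add, ← zpow_add,
            show y * (c' : ℤ) + z * (d' : ℤ) = 1 by linear_combination hyz,
            show -(d' : ℤ) * (c' : ℤ) + (c' : ℤ) * (d' : ℤ) = 0 by ring, zpow_one, zpow_zero,
            mul_one]
        · simp only [mul_zpow, ← zpow_mul]
          rw [mul_mul_mul_comm, ← zpow_add, ← zpow_add,
            show -(d' : ℤ) * -z + (c' : ℤ) * y = 1 by linear_combination hyz,
            show y * -z + z * y = 0 by ring, zpow_one, zpow_zero, one_mul] }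
  have hΦ : ∀ p : G × G, p.1 ^ c * p.2 ^ d = (Φ p).1 ^ k := by
    intro p
    change _ = (p.1 ^ (c' : ℤ) * p.2 ^ (d' : ℤ)) ^ k
    rw [zpow_natCast, zpow_natCast, mul_pow, ← pow_mul, ← pow_mul, mul_comm c' k, mul_comm d' k,
      ← hc', ← hd']
  simp only [Finset.card_filter]
  rw [← Fintype.sum_prod_type' (fun u v : G => if v ^ d = (u ^ c)⁻¹ * b then 1 else 0)]
  have h1 : ∀ p : G × G, (if p.2 ^ d = (p.1 ^ c)⁻¹ * b then 1 else 0) =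
      if (Φ p).1 ^ k = b then 1 else 0 := fun p =>
    if_congr (by rw [← hΦ, eq_inv_mul_iff_mul_eq]) rfl rfl
  rw [Finset.sum_congr rfl fun p _ => h1 p,
    Φ.sum_comp fun p : G × G => if p.1 ^ k = b then 1 else 0,
    Fintype.sum_prod_type_right]
  simp

theorem monomialCount_mul_card (l : List ℕ) (b : G) :
    monomialCount l b * Fintype.card G = Fintype.card G ^ l.length *
      (Finset.univ.filter fun v : G => v ^ l.foldr Nat.gcd (Fintype.card G) = b).card := by
  induction l generalizing b with
  | nil =>
    rw [monomialCount]
    simp only [List.foldr_nil, pow_card_eq_one, List.length_nil, pow_zero, one_mul]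
    by_cases hb : b = 1
    · simp [hb]
    · simp [hb, Ne.symm hb]
  | cons c l ih =>
    have hpos : 0 < l.foldr Nat.gcd (Fintype.card G) := by
      clear ih
      induction l with
      | nil => exact Fintype.card_pos
      | cons c l ih => exact Nat.gcd_pos_of_pos_right _ ih
    rw [monomialCount, Finset.sum_mul, Finset.sum_congr rfl fun u _ => ih _, ← Finset.mul_sum,
      sum_card_pow_eq c hpos, List.length_cons, List.foldr_cons, pow_succ, mul_assoc]

/-- In a cyclic group of order `N`, the equation `v ^ d = b` with `d ∣ N` has `d` solutions if `b`
is a `d`-th power, that is, if `d` divides `N / orderOf b`, and none otherwise. -/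
theorem card_pow_eq_of_isCyclic [IsCyclic G] (b : G) {d : ℕ} (hd : d ∣ Fintype.card G) :
    (Finset.univ.filter fun v : G => v ^ d = b).card =
      if d ∣ Fintype.card G / orderOf b then d else 0 := by
  have hN : 0 < Fintype.card G := Fintype.card_pos
  have hd0 : 0 < d := Nat.pos_of_dvd_of_pos hd hN
  have hiff : (∃ v : G, v ^ d = b) ↔ d ∣ Fintype.card G / orderOf b := by
    have h1 : d ∣ Fintype.card G / orderOf b ↔ orderOf b ∣ Fintype.card G / d := by
      rw [Nat.dvd_div_iff_mul_dvd orderOf_dvd_card, Nat.dvd_div_iff_mul_dvd hd, mul_comm]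
    rw [h1, orderOf_dvd_iff_pow_eq_one]
    constructor
    · rintro ⟨v, rfl⟩
      rw [← pow_mul, Nat.mul_div_cancel' hd, pow_card_eq_one]
    · intro hb
      obtain ⟨γ, hγ⟩ := IsCyclic.exists_generator (α := G)
      obtain ⟨k, rfl⟩ := (mem_powers_iff_mem_zpowers.mpr (hγ b))
      have h2 : orderOf γ = Fintype.card G := orderOf_eq_card_of_forall_mem_zpowers hγ ▸
        Nat.card_eq_fintype_card
      simp only at hb
      rw [← pow_mul, ← orderOf_dvd_iff_pow_eq_one, h2] at hb
      obtain ⟨e, he⟩ := hd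
      rw [he, Nat.mul_div_cancel_left _ hd0] at hb
      have he0 : 0 < e := Nat.pos_of_ne_zero (by rintro rfl; omega)
      obtain ⟨j, rfl⟩ := Nat.dvd_of_mul_dvd_mul_right he0 hb
      exact ⟨γ ^ j, by rw [← pow_mul, mul_comm]⟩
  split_ifs with hdvd
  · obtain ⟨v₀, rfl⟩ := hiff.mpr hdvd
    have hone : (Finset.univ.filter fun v : G => v ^ d = 1).card = d := by
      rw [← Fintype.card_subtype, ← Nat.card_eq_fintype_card]
      refine (IsCyclic.card_powMonoidHom_ker (G := G) d).trans ?_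
      rw [Nat.card_eq_fintype_card, Nat.gcd_eq_right hd]
    conv_rhs => rw [← hone]
    refine Finset.card_bij' (fun v _ => v * v₀⁻¹) (fun v _ => v * v₀) ?_ ?_ ?_ ?_
    · intro v hv
      simp only [Finset.mem_filter, Finset.mem_univ, true_and] at *
      rw [mul_pow, hv, inv_pow, mul_inv_cancel]
    · intro v hv
      simp only [Finset.mem_filter, Finset.mem_univ, true_and] at *
      rw [mul_pow, hv, one_mul]
    · intro v _
      simp
    · intro v _
      simp
  · rw [Finset.card_eq_zero, Finset.filter_eq_empty_iff]
    exact fun v _ hv => hdvd (hiff.mp ⟨v, hv⟩)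

end

/-! ### The probability as a proportion of Toeplitz matrices -/

theorem uniformSequence_cylinder {F : Type*} [Field F] [Fintype F] (p N : ℕ) (t : ℕ → F) :
    (uniformSequence F).real {c | ∀ k < N, c (p + k) = t k} = ((Fintype.card F : ℝ) ^ N)⁻¹ := by
  let _ : MeasurableSpace F := ⊤
  have hset : {c : ℕ → F | ∀ k < N, c (p + k) = t k} =
      Set.pi (Finset.Ico p (p + N)) fun k => {t (k - p)} := by
    ext c
    simp only [Set.mem_ofPred_eq, Set.mem_pi, Finset.coe_Ico, Set.mem_Ico, Set.mem_singleton_iff]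
    constructor
    · rintro hc k ⟨hk1, hk2⟩
      rw [← hc (k - p) (by omega), Nat.add_sub_cancel' hk1]
    · intro hc k hk
      rw [hc (p + k) (by omega), Nat.add_sub_cancel_left]
  rw [hset, MeasureTheory.Measure.real, uniformSequence,
    MeasureTheory.Measure.infinitePi_pi _ fun _ _ => MeasurableSpace.measurableSet_top,
    ENNReal.toReal_prod]
  have h1 : ∀ y : F, ((PMF.uniformOfFintype F).toMeasure {y}).toReal =
      (Fintype.card F : ℝ)⁻¹ := by
    intro y
    rw [PMF.toMeasure_apply_singleton _ _ MeasurableSpace.measurableSet_top,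
      PMF.uniformOfFintype_apply]
    simp
  rw [Finset.prod_congr rfl fun k _ => h1 _, Finset.prod_const, Nat.card_Ico,
    Nat.add_sub_cancel_left, inv_pow]

/-- The probability of an event that depends only on `N` consecutive values is a proportion of
finite sequences. -/
theorem uniformSequence_real_eq_seqCount {F : Type*} [Field F] [Fintype F] (p N : ℕ)
    (Q : (ℕ → F) → Prop) (hQ : ∀ s s' : ℕ → F, (∀ k < N, s k = s' k) → (Q s ↔ Q s')) :
    (uniformSequence F).real {c | Q fun k => c (p + k)} =
      seqCount N Q / (Fintype.card F : ℝ) ^ N := by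
  classical
  let _ : MeasurableSpace F := ⊤
  have hpad : ∀ (t : Fin N → F) (k : Fin N), padSeq t k = t k := fun t k => by
    rw [padSeq, dif_pos k.2]
  have hset : {c : ℕ → F | Q fun k => c (p + k)} =
      ⋃ t ∈ Finset.univ.filter fun t : Fin N → F => Q (padSeq t),
        {c : ℕ → F | ∀ k < N, c (p + k) = padSeq t k} := by
    ext c
    simp only [Set.mem_ofPred_eq, Set.mem_iUnion, Finset.mem_filter, Finset.mem_univ, true_and,
      exists_prop]
    constructor
    · intro hc
      have h1 : ∀ k < N, c (p + k) = padSeq (fun i : Fin N => c (p + i)) k := fun k hk =>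
        (hpad (fun i : Fin N => c (p + i)) ⟨k, hk⟩).symm
      exact ⟨fun i => c (p + i), (hQ _ _ h1).mp hc, h1⟩
    · rintro ⟨t, ht, hct⟩
      exact (hQ _ _ hct).mpr ht
  have hprob : MeasureTheory.IsProbabilityMeasure (uniformSequence F) := by
    unfold uniformSequence
    infer_instance
  rw [hset, MeasureTheory.measureReal_biUnion_finset]
  · rw [Finset.sum_congr rfl fun t _ => uniformSequence_cylinder p N (padSeq t), Finset.sum_const,
      nsmul_eq_mul, seqCount, Nat.card_eq_fintype_card, Fintype.card_subtype, div_eq_mul_inv]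
  · intro t _ t' _ hne
    rw [Function.onFun, Set.disjoint_left]
    intro c hc hc'
    refine hne (funext fun k => ?_)
    rw [← hpad t k, ← hpad t' k, ← hc k k.2, ← hc' k k.2]
  · intro t _
    have h1 : {c : ℕ → F | ∀ k < N, c (p + k) = padSeq t k} =
        ⋂ k : Fin N, (fun c : ℕ → F => c (p + k)) ⁻¹' {padSeq t k} := by
      ext c
      simp [Fin.forall_iff]
    rw [h1]
    exact MeasurableSet.iInter fun k => measurable_pi_apply _ MeasurableSpace.measurableSet_top

theorem P_rectangle_eq_toeplitzCount {F : Type*} [Field F] [Fintype F] {n a : ℕ} (han : n ≤ a)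
    (b : F) : P (rectangle n a) b =
      toeplitzCount n b / (Fintype.card F : ℝ) ^ (2 * n - 1) := by
  have hdet : ∀ (c : ℕ → F) (φ : SymmetricFunctions →+* F), (∀ k, φ (h (k + 1)) = c k) →
      φ (Matrix.of fun i j : Fin n => h (a + j - i)).det =
        (toeplitz n fun k => c (a - n + k)).det := by
    intro c φ hφ
    rw [RingHom.map_det, ← Matrix.det_transpose]
    congr 1
    ext i j
    simp only [RingHom.mapMatrix_apply, Matrix.map_apply, Matrix.of_apply, Matrix.transpose_apply,
      toeplitz]
    rw [← hφ]
    congr 2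
    omega
  have hset : {c : ℕ → F | ∃ φ : SymmetricFunctions →+* F, (∀ k, φ (h (k + 1)) = c k) ∧
      ∃ s : SymmetricFunctions, (s : MvPowerSeries ℕ ℤ) = schur (rectangle n a) ∧ φ s = b} =
      {c | (toeplitz n fun k => c (a - n + k)).det = b} := by
    ext c
    constructor
    · rintro ⟨φ, hφ, s, hs, hb⟩
      rw [schur_rectangle_eq_det han] at hs
      rw [Set.mem_ofPred_eq, ← hdet c φ hφ, ← Subtype.ext hs, hb]
    · intro hc
      obtain ⟨φ, hφ⟩ := exists_ringHom_apply_h c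
      exact ⟨φ, hφ, _, (schur_rectangle_eq_det han).symm, (hdet c φ hφ).trans hc⟩
  rw [P, hset, toeplitzCount]
  refine uniformSequence_real_eq_seqCount (a - n) (2 * n - 1) (fun s => (toeplitz n s).det = b) ?_
  intro s s' hs
  have h1 : toeplitz n s = toeplitz n s' := by
    ext i j
    exact hs _ (by omega)
  rw [h1]

/-! ### The closed formulas -/

section

variable {F : Type*} [Field F] [Fintype F]

/-- Composing the steps of the recursion `toeplitzCount_succ`: Toeplitz matrices correspond to
solutions of monomial equations indexed by compositions. -/
theorem toeplitzCount_eq_sum_composition [Fintype Fˣ] [DecidableEq Fˣ] {n : ℕ} (hn : 1 ≤ n)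
    (b : Fˣ) : toeplitzCount n (b : F) =
      Fintype.card F ^ (n - 1) * ∑ c : Composition n, monomialCount c.blocks b := by
  classical
  induction n using Nat.strong_induction_on generalizing b with
  | _ n ih =>
    obtain ⟨n, rfl⟩ : ∃ k, n = k + 1 := ⟨n - 1, by omega⟩
    rw [toeplitzCount_succ n b.ne_zero, sum_composition_succ n fun l => monomialCount l b,
      Finset.sum_range_succ, mul_add, Nat.add_sub_cancel]
    refine congrArg₂ _ ?_ ?_
    · rw [Finset.mul_sum]
      refine Finset.sum_congr rfl fun i hi => ?_
      have hin := Finset.mem_range.mp hi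
      simp only [monomialCount]
      rw [Finset.sum_comm, Finset.mul_sum]
      refine Finset.sum_congr rfl fun u _ => ?_
      have h1 := ih (n - i) (by omega) (by omega) ((u ^ (i + 1))⁻¹ * b)
      rw [Units.val_mul, Units.val_inv_eq_inv_val, Units.val_pow_eq_pow_val] at h1
      rw [h1, ← mul_assoc, ← pow_add, show i + 1 + (n - i - 1) = n by omega]
    · rw [← Finset.mul_sum]
      congr 1
      rw [sum_composition_of_eq_zero (Nat.sub_self n) fun l => monomialCount ((n + 1) :: l) b]
      simp only [monomialCount]
      refine Finset.sum_congr rfl fun u _ => if_congr ?_ rfl rfl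
      rw [inv_mul_eq_one, ← Units.val_inj, Units.val_pow_eq_pow_val]

theorem monomialCount_units_eq [Fintype Fˣ] [DecidableEq Fˣ] (b : Fˣ) {n : ℕ} (hn : 1 ≤ n)
    (c : Composition n) :
    monomialCount c.blocks b = (Fintype.card F - 1) ^ (c.length - 1) *
      g (b : F) (partsGcd c (Fintype.card F - 1)) := by
  classical
  have hcard : Fintype.card Fˣ = Fintype.card F - 1 := by
    rw [Fintype.card_congr unitsEquivNeZero, Fintype.card_subtype_compl, Fintype.card_subtype_eq]
  have hdvd : partsGcd c (Fintype.card F - 1) ∣ Fintype.card Fˣ := by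
    rw [hcard, partsGcd]
    induction c.blocks with
    | nil => exact dvd_rfl
    | cons k l ih => exact (Nat.gcd_dvd_right _ _).trans ih
  have h1 := monomialCount_mul_card c.blocks b
  rw [hcard, ← partsGcd, card_pow_eq_of_isCyclic b hdvd, hcard] at h1
  have hlen : c.blocks.length = (c.length - 1) + 1 := by
    have := c.length_pos_iff.mpr hn
    rw [c.blocks_length]
    omega
  rw [hlen, pow_succ] at h1
  have hpos : 0 < Fintype.card F - 1 := hcard ▸ Fintype.card_pos
  refine Nat.eq_of_mul_eq_mul_right hpos (h1.trans ?_)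
  rw [g, orderOf_units]
  ring

/-- The composition formula. -/
theorem P_rectangle_eq_sum_composition {n a : ℕ} (hn : 1 ≤ n) (han : n ≤ a) {b : F} (hb : b ≠ 0) :
    P (rectangle n a) b = ∑ c : Composition n,
      ((Fintype.card F : ℝ) - 1) ^ (c.length - 1) / (Fintype.card F : ℝ) ^ n *
        (g b (partsGcd c (Fintype.card F - 1)) : ℝ) := by
  classical
  have hq : (Fintype.card F : ℝ) ≠ 0 := by exact_mod_cast Fintype.card_ne_zero
  have h1 := toeplitzCount_eq_sum_composition hn (Units.mk0 b hb)
  rw [Finset.sum_congr rfl fun c _ => monomialCount_units_eq (Units.mk0 b hb) hn c,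
    Units.val_mk0] at h1
  rw [P_rectangle_eq_toeplitzCount han, h1, show 2 * n - 1 = n - 1 + n by omega, pow_add]
  push_cast [Nat.cast_sub (Fintype.card_pos (α := F))]
  rw [mul_div_mul_left _ _ (pow_ne_zero _ hq), Finset.sum_div]
  exact Finset.sum_congr rfl fun c _ => by ring

theorem dvd_partsGcd_iff {n : ℕ} (c : Composition n) (m d : ℕ) :
    d ∣ partsGcd c m ↔ d ∣ m ∧ ∀ k ∈ c.blocks, d ∣ k := by
  rw [partsGcd]
  induction c.blocks with
  | nil => simp
  | cons k l ih =>
    rw [List.foldr_cons, Nat.dvd_gcd_iff, ih, List.forall_mem_cons]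
    tauto

/-- Möbius inversion of the definition of `f`. -/
theorem sum_divisors_f (b : F) {m : ℕ} (hm : 0 < m) :
    ∑ d ∈ m.divisors, f b d = (g b m : ℤ) := by
  refine (ArithmeticFunction.sum_eq_iff_sum_mul_moebius_eq (R := ℤ) (f := f b)
    (g := fun m => (g b m : ℤ))).mpr (fun d _ => ?_) m hm
  rw [f]
  exact Nat.sum_divisorsAntidiagonal fun i j => ArithmeticFunction.moebius i * (g b j : ℤ)

/-- The weighted number of compositions with all parts divisible by `d`. -/
theorem sum_composition_dvd_pow_length_sub_one {x : ℝ} (hx : x ≠ 0) {d : ℕ} (hd : 0 < d) {n : ℕ}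
    (hn : 0 < n) :
    (∑ c : Composition n, if ∀ k ∈ c.blocks, d ∣ k then x ^ (c.length - 1) else 0) =
      if d ∣ n then (x + 1) ^ (n / d - 1) else 0 := by
  have h1 := sum_composition_dvd x hd hn
  refine mul_left_cancel₀ hx ?_
  rw [mul_ite, mul_zero, ← h1, Finset.mul_sum]
  refine Finset.sum_congr rfl fun c _ => ?_
  rw [mul_ite, mul_zero, ← pow_succ', Nat.sub_add_cancel (c.length_pos_iff.mpr hn)]

/-- The divisor formula, from the composition formula by writing `g` as a divisor sum of `f` and
exchanging the sums. -/
theorem P_rectangle_eq_sum_divisors {n a : ℕ} (hn : 1 ≤ n) (han : n ≤ a) {b : F} (hb : b ≠ 0) :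
    P (rectangle n a) b = ∑ d ∈ (Nat.gcd (Fintype.card F - 1) n).divisors,
      (f b d : ℝ) / (Fintype.card F : ℝ) ^ (n * (d - 1) / d + 1) := by
  set q := Fintype.card F with hq
  have hq1 : 1 < q := Fintype.one_lt_card
  have hq0 : (q : ℝ) ≠ 0 := by exact_mod_cast (by omega : q ≠ 0)
  have hx : (q : ℝ) - 1 ≠ 0 := sub_ne_zero.mpr (by exact_mod_cast hq1.ne')
  have hg : ∀ c : Composition n, (g b (partsGcd c (q - 1)) : ℝ) =
      ∑ d ∈ (q - 1).divisors, if ∀ k ∈ c.blocks, d ∣ k then (f b d : ℝ) else 0 := by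
    intro c
    have h0 : partsGcd c (q - 1) ∣ q - 1 := ((dvd_partsGcd_iff c (q - 1) _).mp dvd_rfl).1
    have hpos : 0 < partsGcd c (q - 1) := Nat.pos_of_dvd_of_pos h0 (by omega)
    have h1 : (g b (partsGcd c (q - 1)) : ℝ) = ((g b (partsGcd c (q - 1)) : ℤ) : ℝ) := by simp
    rw [h1, ← sum_divisors_f b hpos, Int.cast_sum, ← Finset.sum_filter]
    refine Finset.sum_congr (Finset.ext fun d => ?_) fun _ _ => rfl
    rw [Finset.mem_filter, Nat.mem_divisors, Nat.mem_divisors, dvd_partsGcd_iff]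
    have h2 : q - 1 ≠ 0 := by omega
    have h3 := hpos.ne'
    tauto
  have hdiv : (Nat.gcd (q - 1) n).divisors = (q - 1).divisors.filter (· ∣ n) := by
    ext d
    rw [Finset.mem_filter, Nat.mem_divisors, Nat.mem_divisors, Nat.dvd_gcd_iff]
    have h1 : q - 1 ≠ 0 := by omega
    have h2 : Nat.gcd (q - 1) n ≠ 0 := Nat.gcd_ne_zero_left h1
    tauto
  rw [P_rectangle_eq_sum_composition hn han hb, hdiv, Finset.sum_filter]
  simp only [← hq, hg, Finset.mul_sum]
  rw [Finset.sum_comm]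
  refine Finset.sum_congr rfl fun d hd => ?_
  have hd0 : 0 < d := Nat.pos_of_mem_divisors hd
  have h1 := sum_composition_dvd_pow_length_sub_one hx hd0 hn
  rw [sub_add_cancel] at h1
  have h2 : ∀ c : Composition n, ((q : ℝ) - 1) ^ (c.length - 1) / (q : ℝ) ^ n *
      (if ∀ k ∈ c.blocks, d ∣ k then (f b d : ℝ) else 0) = (f b d : ℝ) / (q : ℝ) ^ n *
        if ∀ k ∈ c.blocks, d ∣ k then ((q : ℝ) - 1) ^ (c.length - 1) else 0 := by
    intro c
    split_ifs
    · ring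
    · simp
  rw [Finset.sum_congr rfl fun c _ => h2 c, ← Finset.mul_sum, h1, mul_ite, mul_zero]
  refine ite_congr rfl (fun hdn => ?_) fun _ => rfl
  obtain ⟨m, rfl⟩ := hdn
  have hm : 0 < m := Nat.pos_of_mul_pos_left hn
  obtain ⟨m, rfl⟩ : ∃ k, m = k + 1 := ⟨m - 1, by omega⟩
  obtain ⟨d, rfl⟩ : ∃ k, d = k + 1 := ⟨d - 1, by omega⟩
  rw [Nat.mul_div_cancel_left _ hd0, Nat.add_sub_cancel, Nat.add_sub_cancel, mul_assoc,
    Nat.mul_div_cancel_left _ hd0, div_mul_eq_mul_div, div_eq_div_iff (pow_ne_zero _ hq0)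
      (pow_ne_zero _ hq0), mul_assoc, ← pow_add]
  congr 2
  ring

theorem f_eq_moebius {b : F} (hb : orderOf b = Fintype.card F - 1) {d : ℕ} (hd : 0 < d) :
    f b d = ArithmeticFunction.moebius d := by
  have hpos : 0 < Fintype.card F - 1 := by
    have := Fintype.one_lt_card (α := F)
    omega
  rw [f, Finset.sum_eq_single d]
  · rw [g, hb, Nat.div_self hpos, Nat.div_self hd, if_pos dvd_rfl, Nat.cast_one, mul_one]
  · intro e he hne
    have h1 : d / e ≠ 1 := fun h1 => hne
      (by rw [← Nat.div_mul_cancel (Nat.dvd_of_mem_divisors he), h1, one_mul])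
    rw [g, hb, Nat.div_self hpos, if_neg (fun h2 => h1 (Nat.dvd_one.mp h2)), Nat.cast_zero,
      mul_zero]
  · intro hd'
    exact absurd (Nat.mem_divisors_self d hd.ne') hd'

theorem f_one_eq_totient {d : ℕ} (hd : d ∣ Fintype.card F - 1) :
    f (1 : F) d = (Nat.totient d : ℤ) := by
  have hpos : 0 < Fintype.card F - 1 := by
    have := Fintype.one_lt_card (α := F)
    omega
  have h1 := (ArithmeticFunction.sum_eq_iff_sum_mul_moebius_eq (R := ℤ)
    (f := fun m => (Nat.totient m : ℤ)) (g := fun m => (m : ℤ))).mp (fun m _ => by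
      rw [← Nat.cast_sum, Nat.sum_totient]) d (Nat.pos_of_dvd_of_pos hd hpos)
  rw [← h1, f]
  refine Eq.trans ?_
    (Nat.sum_divisorsAntidiagonal fun i j => ArithmeticFunction.moebius i * (j : ℤ)).symm
  refine Finset.sum_congr rfl fun e he => ?_
  rw [g, orderOf_one, Nat.div_one,
    if_pos ((Nat.div_dvd_of_dvd (Nat.dvd_of_mem_divisors he)).trans hd)]

end

end SchurProb

theorem mainTheorem7 {F : Type*} [Field F] [Fintype F] (q : ℕ) (hq : Fintype.card F = q)
    (n a : ℕ) (hn : 1 ≤ n) (han : n ≤ a) (b : F) (hb : b ≠ 0) :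
    (SchurProb.P (SchurProb.rectangle n a) b =
        ∑ d ∈ (Nat.gcd (q - 1) n).divisors,
          (SchurProb.f b d : ℝ) / (q : ℝ) ^ (n * (d - 1) / d + 1)) ∧
    (SchurProb.P (SchurProb.rectangle n a) b =
        ∑ c : Composition n, ((q : ℝ) - 1) ^ (c.length - 1) / (q : ℝ) ^ n *
          (SchurProb.g b (SchurProb.partsGcd c (q - 1)) : ℝ)) ∧
    (orderOf b = q - 1 →
      SchurProb.P (SchurProb.rectangle n a) b =
        ∑ d ∈ (Nat.gcd (q - 1) n).divisors,
          (ArithmeticFunction.moebius d : ℝ) / (q : ℝ) ^ (n * (d - 1) / d + 1)) ∧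
    (SchurProb.P (SchurProb.rectangle n a) (1 : F) =
        ∑ d ∈ (Nat.gcd (q - 1) n).divisors,
          (Nat.totient d : ℝ) / (q : ℝ) ^ (n * (d - 1) / d + 1)) := by
  subst hq
  refine ⟨SchurProb.P_rectangle_eq_sum_divisors hn han hb,
    SchurProb.P_rectangle_eq_sum_composition hn han hb, fun hord => ?_, ?_⟩
  · rw [SchurProb.P_rectangle_eq_sum_divisors hn han hb]
    refine Finset.sum_congr rfl fun d hd => ?_
    rw [SchurProb.f_eq_moebius hord (Nat.pos_of_mem_divisors hd)]
  · rw [SchurProb.P_rectangle_eq_sum_divisors hn han one_ne_zero]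
    refine Finset.sum_congr rfl fun d hd => ?_
    rw [SchurProb.f_one_eq_totient
      ((Nat.dvd_of_mem_divisors hd).trans (Nat.gcd_dvd_left _ _)), Int.cast_natCast]
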